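/- **Conventions.** A drawing of a finite simple graph assigns to the vertices distinct points of $\mathbb{R}^2$ and to every edge a curve in $\mathbb{R}^2$ between the points of its two ends. All drawings are good: an edge-curve meets vertex-points only at its two ends; no edge-curve intersects itself; two edge-curves have at most one point in common, and if this point is not a common end then they cross properly there; three edge-curves have a point in common only if it is a common end of them. A drawing is $k$-planar if every edge takes part in at most $k$ crossings, and planar if it is $0$-planar. A 1-planar drawing of a simple graph is simple-saturated if no edge between two distinct non-adjacent vertices can be added to the drawing (keeping the points and the curves that are there) such that the result is again a good 1-planar drawing. A graph is 3-connected if it has more than 3 vertices and stays connected after the deletion of any set of at most 2 vertices (the empty set included). $\mu(G)$ is the size of a maximum matching of $G$. The bipyramid $B_s$ consists of a base-cycle $b_0,\dots,b_{s-3}$ of length $s-2$ and two non-adjacent apices $c,c'$, both adjacent to all vertices of the base-cycle. Its $2s-4$ faces are the triangles $a\,b_i\,b_{i+1}$ with $a\in\{c,c'\}$ and indices modulo $s-2$; the face $a\,b_i\,b_{i+1}$ is paired with its apex-edge $a\,b_i$. Inserting a crossed $K_4$ into each face of a planar drawing of $B_s$ means: for every face $F=a\,b_i\,b_{i+1}$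 add a new vertex $z_F$ inside $F$, join it to $a,b_i,b_{i+1}$ by edges inside $F$, and re-route the paired edge $a\,b_i$ through the inside of $F$ so that it crosses the edge $z_F\,b_{i+1}$; the vertices and the base-edges of $B_s$ stay in place. **Theorem.** For every $N$ there is an even $s\ge 8$ and a simple-saturated 1-planar drawing $\Gamma_3$ that is obtained from a planar drawing of $B_s$ by inserting a crossed $K_4$ into each face, such that the graph of $\Gamma_3$ has $n\ge N$ vertices, is 3-connected, and satisfies $\mu(\Gamma_3)\le\frac{n+4}{3}$. -/

import Mathlib

/-- The plane `ℝ²`; only its topology matters below. -/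
abbrev Plane : Type := ℝ × ℝ

/-- Two point sets `A`, `B` cross properly at `p`: some chart of the plane around `p` carries
`p` to the origin, `A` to the first coordinate axis and `B` to the second coordinate axis. -/
def ProperlyCrossAt (A B : Set Plane) (p : Plane) : Prop :=
  ∃ h : OpenPartialHomeomorph Plane Plane, p ∈ h.source ∧ h p = 0 ∧
    ∀ q ∈ h.source, (q ∈ A ↔ (h q).2 = 0) ∧ (q ∈ B ↔ (h q).1 = 0)

/-- A (good) drawing of a simple graph in the plane. -/
structure Drawing {V : Type*} (G : SimpleGraph V) where
  /-- the point that represents a vertex -/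
  pos : V → Plane
  /-- the curve that represents an edge -/
  curve : G.edgeSet → C(unitInterval, Plane)
  /-- an edge-curve connects the points of the two ends of the edge -/
  ends : ∀ e, s(curve e 0, curve e 1) = Sym2.map pos e.1
  /-- no two vertex-points coincide -/
  pos_injective : Function.Injective pos
  /-- an edge-curve meets vertex-points only at its two ends -/
  vertex_on_curve : ∀ e t v, curve e t = pos v → t = 0 ∨ t = 1
  /-- edge-curves that meet in a point other than a common end cross properly there -/
  proper : ∀ e f, e ≠ f → ∀ p, p ∈ Set.range (curve e) → p ∈ Set.range (curve f) →
    (¬ ∃ v, v ∈ e.1 ∧ v ∈ f.1 ∧ p = pos v) →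
      ProperlyCrossAt (Set.range (curve e)) (Set.range (curve f)) p
  /-- three edge-curves meet only in a common end -/
  three : ∀ e f g, e ≠ f → f ≠ g → e ≠ g → ∀ p, p ∈ Set.range (curve e) →
    p ∈ Set.range (curve f) → p ∈ Set.range (curve g) →
      ∃ v, v ∈ e.1 ∧ v ∈ f.1 ∧ v ∈ g.1 ∧ p = pos v
  /-- two edge-curves meet at most once (a simple graph has no parallel edges) -/
  meet_once : ∀ e f, e ≠ f → (Set.range (curve e) ∩ Set.range (curve f)).Subsingleton
  /-- no edge-curve intersects itself (a simple graph has no loops) -/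
  curve_injective : ∀ e, Function.Injective (curve e)

namespace Drawing

variable {V : Type*} {G G' : SimpleGraph V}

/-- The edges `e` and `f` cross at the point `p`. -/
def CrossAt (D : Drawing G) (e f : G.edgeSet) (p : Plane) : Prop :=
  e ≠ f ∧ p ∈ Set.range (D.curve e) ∧ p ∈ Set.range (D.curve f) ∧
    ¬ ∃ v, v ∈ e.1 ∧ v ∈ f.1 ∧ p = D.pos v

/-- Every edge participates in at most `k` crossings. -/
def IsKPlanar (k : ℕ) (D : Drawing G) : Prop :=
  ∀ e, {p : Plane | ∃ f, D.CrossAt e f p}.encard ≤ k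

/-- `D'` arises from `D` by adding edges: vertex-points and old edge-curves are unchanged. -/
def Extends (D' : Drawing G') (D : Drawing G) : Prop :=
  G ≤ G' ∧ D'.pos = D.pos ∧
    ∀ (e : G.edgeSet) (e' : G'.edgeSet), e'.1 = e.1 → D'.curve e' = D.curve e

/-- A simple-saturated 1-planar drawing: it is 1-planar, it represents a simple graph, and no
edge between distinct non-adjacent vertices can be added to it so that it stays 1-planar. -/
def IsSimpleSaturated (D : Drawing G) : Prop :=
  D.IsKPlanar 1 ∧ ∀ u v : V, u ≠ v → ¬ G.Adj u v →
    ∀ D' : Drawing (G ⊔ SimpleGraph.edge u v), D'.Extends D → ¬ D'.IsKPlanar 1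

/-- The points of the plane that are covered by a drawing. -/
def support (D : Drawing G) : Set Plane :=
  Set.range D.pos ∪ ⋃ e, Set.range (D.curve e)

/-- The faces of a planar drawing are the connected components of the complement. -/
def IsFace (D : Drawing G) (R : Set Plane) : Prop :=
  ∃ x ∈ D.supportᶜ, R = connectedComponentIn D.supportᶜ x

end Drawing

/-- `k`-connectivity: more than `k` vertices, and connected after the deletion of any fewer than
`k` vertices (of none, in particular). -/
def IsKConnected {V : Type*} [Fintype V] (k : ℕ) (G : SimpleGraph V) : Prop :=
  k < Fintype.card V ∧ ∀ S : Finset V, S.card < k → (G.induce ((S : Set V)ᶜ)).Connected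

/-- `μ(G)`, the size of a maximum matching of a finite graph. -/
noncomputable def matchingNumber {V : Type*} [Finite V] (G : SimpleGraph V) : ℕ :=
  sSup {m | ∃ M : G.Subgraph, M.IsMatching ∧ M.edgeSet.ncard = m}

/-- The vertices of the bipyramid `B_s`: the `s - 2` vertices of the base-cycle, two apices. -/
abbrev BipyramidVertex (s : ℕ) : Type := Fin (s - 2) ⊕ Bool

/-- The bipyramid `B_s`: the base-cycle, and two non-adjacent apices joined to all of it. -/
def bipyramid (s : ℕ) : SimpleGraph (BipyramidVertex s) where
  Adj
    | .inl i, .inl j => (SimpleGraph.cycleGraph (s - 2)).Adj i j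
    | .inl _, .inr _ => True
    | .inr _, .inl _ => True
    | .inr _, .inr _ => False
  symm := ⟨by
    rintro (i | a) (j | b) h
    · exact SimpleGraph.Adj.symm h
    · trivial
    · trivial
    · exact h⟩
  loopless := ⟨by
    rintro (i | a) h
    · exact SimpleGraph.irrefl _ h
    · exact h⟩

/-- The `2s - 4` faces of `B_s`: `(i, a)` stands for the triangle of the apex `a` and the
base-edge from `i` to its successor on the base-cycle. -/
abbrev BipyramidFace (s : ℕ) : Type := Fin (s - 2) × Bool

namespace BipyramidFace

variable {s : ℕ}

/-- the apex of the face -/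
def apex (F : BipyramidFace s) : BipyramidVertex s := .inr F.2

/-- the first base-vertex of the face -/
def left (F : BipyramidFace s) : BipyramidVertex s := .inl F.1

/-- the second base-vertex of the face: the successor of the first one on the base-cycle -/
def right (F : BipyramidFace s) : BipyramidVertex s := .inl (finRotate (s - 2) F.1)

/-- The three vertices of the face. -/
def verts (F : BipyramidFace s) : Set (BipyramidVertex s) := {F.apex, F.left, F.right}

end BipyramidFace

/-- The graph obtained from `B_s` by inserting `K_4` into each face: one new vertex for every
face, adjacent to the three vertices of the face. -/
def bipyramidK4 (s : ℕ) : SimpleGraph (BipyramidVertex s ⊕ BipyramidFace s) where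
  Adj
    | .inl u, .inl v => (bipyramid s).Adj u v
    | .inl u, .inr F => u ∈ F.verts
    | .inr F, .inl u => u ∈ F.verts
    | .inr _, .inr _ => False
  symm := ⟨by
    rintro (i | a) (j | b) h
    · exact SimpleGraph.Adj.symm h
    · exact h
    · exact h
    · exact h⟩
  loopless := ⟨by
    rintro (i | a) h
    · exact SimpleGraph.irrefl _ h
    · exact h⟩

/-- The drawing `D` is obtained from the planar drawing `B` of `B_s` by inserting a crossed `K_4`
into each face. Every face `F` is paired with the apex-edge from `F.apex` to `F.left`. The new
vertex of `F` and its three edges are drawn inside `F`, and the paired edge is re-routed through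
`F` so that it crosses the edge from the new vertex to the remaining vertex `F.right`. -/
structure IsCrossedK4Insertion {s : ℕ} (B : Drawing (bipyramid s))
    (D : Drawing (bipyramidK4 s)) : Prop where
  /-- the drawing of `B_s` is planar -/
  planar : B.IsKPlanar 0
  /-- the vertices of `B_s` stay in place -/
  pos_eq : ∀ v, D.pos (.inl v) = B.pos v
  /-- the base-edges stay in place -/
  base_eq : ∀ (i j : Fin (s - 2)) (e : (bipyramid s).edgeSet) (e' : (bipyramidK4 s).edgeSet),
    e.1 = s(.inl i, .inl j) → e'.1 = s(.inl (.inl i), .inl (.inl j)) → D.curve e' = B.curve e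
  /-- for each `F` there is a face `R` of the planar drawing, bounded by the three edges of `F`,
  whose inside contains the new vertex and, up to their ends, its edges and the paired edge -/
  inside : ∀ F : BipyramidFace s, ∃ R : Set Plane, B.IsFace R ∧
    frontier R =
      (⋃ (e : (bipyramid s).edgeSet) (_ : ∀ v ∈ e.1, v ∈ F.verts), Set.range (B.curve e)) ∧
    D.pos (.inr F) ∈ R ∧
    ∀ e : (bipyramidK4 s).edgeSet,
      (.inr F ∈ e.1 ∨ e.1 = s(.inl F.apex, .inl F.left)) →
        ∀ t, t ≠ 0 → t ≠ 1 → D.curve e t ∈ R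
  /-- the paired edge of `F` crosses the edge from the new vertex to `F.right` -/
  crossing : ∀ (F : BipyramidFace s) (e f : (bipyramidK4 s).edgeSet),
    e.1 = s(.inl F.apex, .inl F.left) → f.1 = s(.inr F, .inl F.right) → ∃ p, D.CrossAt e f p

/-!
For even `s ≥ 8` the drawing is written down explicitly. The sphere is regarded as the suspension of
a circle of length `s - 2`: the base-cycle of the bipyramid is the equator, the apices are the poles,
and every face is a rectangular cell `[0, 1] × [0, 1]` one side of which is collapsed to a pole. A
Möbius transformation that sends an inner point of one cell to infinity turns this into coordinates
on the plane (`cellPoint`). Three facts about these coordinates carry all the topology: when two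
coordinates give the same point (`cellPoint_eq_iff`), that every point has coordinates
(`exists_cellPoint_eq`), and that a closed set of coordinates in one cell describes a closed set of
the plane (`isClosed_cellImage`). Since the cells cover the plane, an open part of an open cell is
then open in the plane as well (`isOpen_cellImage`), which gives the charts for the proper crossings
and identifies the open cells as the faces of the bipyramid, without the Jordan curve theorem.

Inside a cell all edges are straight segments (`Shape.coord`), so that crossings are a matter of
linear inequalities. `CurveSystem` collects what has to be checked for such a family of curves to be
a good drawing.

Saturation (`isSimpleSaturated`): an edge that is added to the drawing so that it stays 1-planar
meets no edge that was crossed before. The crossed edges cut the plane into regions, and the inside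
of the new edge, being connected, lies in one of them (`IsPreconnected.subset_region`); so both ends
are in one closed region. But the vertices of a closed region are an inserted vertex with the apex
and the first base-vertex of its cell, or the two ends of a base-edge, and these are pairwise
adjacent.

The matching bound holds because the `2 s - 4` inserted vertices are pairwise non-adjacent, so a
matching has at most `s` edges, where `n = 3 s - 4`.
-/

/-! ### Drawings from indexed families of curves -/

/-- Data from which a good drawing is assembled. The edges of `G` are indexed by a type `K` that
knows the two ends of an edge, and it is recorded which pairs of indices may cross; each index is
in at most one such pair. -/
structure CurveSystem {V : Type*} (G : SimpleGraph V) (K : Type*) where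
  /-- the point that represents a vertex -/
  pos : V → Plane
  /-- the end at which the curve starts -/
  src : K → V
  /-- the end at which the curve stops -/
  tgt : K → V
  /-- the curve with a given index -/
  curve : K → C(unitInterval, Plane)
  /-- the relation of being a crossing pair -/
  Cross : K → K → Prop
  pos_injective : Function.Injective pos
  exists_index : ∀ e : G.edgeSet, ∃ k, s(src k, tgt k) = e.1
  curve_zero : ∀ k, curve k 0 = pos (src k)
  curve_one : ∀ k, curve k 1 = pos (tgt k)
  curve_injective : ∀ k, Function.Injective (curve k)
  vertex_on_curve : ∀ k t v, curve k t = pos v → t = 0 ∨ t = 1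
  cross_of_meet : ∀ k l t u, k ≠ l → t ≠ 0 → t ≠ 1 → u ≠ 0 → u ≠ 1 →
    curve k t = curve l u → Cross k l
  cross_unique : ∀ k l m, Cross k l → Cross k m → l = m
  cross_disjoint : ∀ k l, Cross k l → ∀ v, v ∈ s(src k, tgt k) → v ∉ s(src l, tgt l)
  cross_subsingleton : ∀ k l, Cross k l →
    (Set.range (curve k) ∩ Set.range (curve l)).Subsingleton
  cross_proper : ∀ k l, Cross k l → ∀ p, p ∈ Set.range (curve k) → p ∈ Set.range (curve l) →
    ProperlyCrossAt (Set.range (curve k)) (Set.range (curve l)) p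

namespace CurveSystem

variable {V : Type*} {G : SimpleGraph V} {K : Type*} (S : CurveSystem G K)

/-- The index of an edge. -/
noncomputable def index (e : G.edgeSet) : K := (S.exists_index e).choose

lemma ends_index (e : G.edgeSet) : s(S.src (S.index e), S.tgt (S.index e)) = e.1 :=
  (S.exists_index e).choose_spec

lemma index_injective : Function.Injective S.index := fun e f h => by
  apply Subtype.ext
  rw [← S.ends_index e, ← S.ends_index f, h]

lemma mem_ends_of_curve_eq {k : K} {t : unitInterval} {v : V} (h : S.curve k t = S.pos v) :
    v ∈ s(S.src k, S.tgt k) := by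
  rcases S.vertex_on_curve k t v h with rfl | rfl
  · rw [S.curve_zero] at h
    simp [S.pos_injective h]
  · rw [S.curve_one] at h
    simp [S.pos_injective h]

lemma curve_mem_pos {k : K} {t : unitInterval} (h : t = 0 ∨ t = 1) :
    ∃ v, S.curve k t = S.pos v := by
  rcases h with rfl | rfl
  · exact ⟨_, S.curve_zero k⟩
  · exact ⟨_, S.curve_one k⟩

/-- Two distinct curves meet in a common end or cross. -/
lemma common_end_or_cross {k l : K} (hkl : k ≠ l) {p : Plane} (hk : p ∈ Set.range (S.curve k))
    (hl : p ∈ Set.range (S.curve l)) :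
    (∃ v, v ∈ s(S.src k, S.tgt k) ∧ v ∈ s(S.src l, S.tgt l) ∧ p = S.pos v) ∨ S.Cross k l := by
  obtain ⟨t, rfl⟩ := hk
  obtain ⟨u, hu⟩ := hl
  by_cases ht : t = 0 ∨ t = 1
  · obtain ⟨v, hv⟩ := S.curve_mem_pos (k := k) ht
    exact .inl ⟨v, S.mem_ends_of_curve_eq hv, S.mem_ends_of_curve_eq (hu.trans hv), hv⟩
  by_cases hu' : u = 0 ∨ u = 1
  · obtain ⟨v, hv⟩ := S.curve_mem_pos (k := l) hu'
    exact .inl ⟨v, S.mem_ends_of_curve_eq (hu.symm.trans hv), S.mem_ends_of_curve_eq hv,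
      hu.symm.trans hv⟩
  push Not at ht hu'
  exact .inr (S.cross_of_meet k l t u hkl ht.1 ht.2 hu'.1 hu'.2 hu.symm)

/-- The drawing given by a system of curves. -/
noncomputable def toDrawing : Drawing G where
  pos := S.pos
  curve e := S.curve (S.index e)
  ends e := by
    rw [S.curve_zero, S.curve_one, ← S.ends_index e, Sym2.map_mk]
  pos_injective := S.pos_injective
  vertex_on_curve e := S.vertex_on_curve _
  proper e f hef p he hf hp := by
    rcases S.common_end_or_cross (S.index_injective.ne hef) he hf with h | h
    · simp only [S.ends_index] at h
      exact absurd h hp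
    · exact S.cross_proper _ _ h p he hf
  three e f g hef hfg heg p he hf hg := by
    rcases S.common_end_or_cross (S.index_injective.ne hef) he hf with ⟨v, hv, hv', rfl⟩ | h
    · obtain ⟨t, ht⟩ := hg
      refine ⟨v, ?_, ?_, ?_, rfl⟩
      · rwa [S.ends_index] at hv
      · rwa [S.ends_index] at hv'
      · simpa only [S.ends_index] using S.mem_ends_of_curve_eq ht
    · rcases S.common_end_or_cross (S.index_injective.ne heg) he hg with ⟨v, hv, _, rfl⟩ | h'
      · obtain ⟨t, ht⟩ := hf
        exact absurd (S.mem_ends_of_curve_eq ht) (S.cross_disjoint _ _ h v hv)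
      · exact absurd (S.index_injective (S.cross_unique _ _ _ h h')) hfg
  meet_once e f hef p hp q hq := by
    by_cases hc : S.Cross (S.index e) (S.index f)
    · exact S.cross_subsingleton _ _ hc hp hq
    · obtain ⟨v, hv, hv', rfl⟩ :=
        (S.common_end_or_cross (S.index_injective.ne hef) hp.1 hp.2).resolve_right hc
      obtain ⟨w, hw, hw', rfl⟩ :=
        (S.common_end_or_cross (S.index_injective.ne hef) hq.1 hq.2).resolve_right hc
      rw [S.ends_index] at hv hv' hw hw'
      by_cases hvw : v = w
      · rw [hvw]
      · refine absurd (Subtype.ext ?_) hef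
        rw [(Sym2.mem_and_mem_iff hvw).1 ⟨hv, hw⟩, (Sym2.mem_and_mem_iff hvw).1 ⟨hv', hw'⟩]
  curve_injective e := S.curve_injective _

lemma cross_of_crossAt {e f : G.edgeSet} {p : Plane} (h : S.toDrawing.CrossAt e f p) :
    S.Cross (S.index e) (S.index f) := by
  obtain ⟨hef, he, hf, hp⟩ := h
  rcases S.common_end_or_cross (S.index_injective.ne hef) he hf with h | h
  · simp only [S.ends_index] at h
    exact absurd h hp
  · exact h

lemma crossAt_of_cross {e f : G.edgeSet} (h : S.Cross (S.index e) (S.index f)) {p : Plane}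
    (he : p ∈ Set.range (S.curve (S.index e))) (hf : p ∈ Set.range (S.curve (S.index f))) :
    S.toDrawing.CrossAt e f p := by
  have hd := S.cross_disjoint _ _ h
  rw [S.ends_index, S.ends_index] at hd
  refine ⟨?_, he, hf, ?_⟩
  · rintro rfl
    rcases e with ⟨⟨a, b⟩, _⟩
    exact hd a (Sym2.mem_mk_left a b) (Sym2.mem_mk_left a b)
  · rintro ⟨v, hv, hv', -⟩
    exact hd v hv hv'

lemma isKPlanar_one : S.toDrawing.IsKPlanar 1 := by
  intro e
  rw [Nat.cast_one, Set.encard_le_one_iff_subsingleton]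
  rintro p ⟨f, hf⟩ q ⟨g, hg⟩
  obtain rfl := S.index_injective
    (S.cross_unique _ _ _ (S.cross_of_crossAt hf) (S.cross_of_crossAt hg))
  exact S.cross_subsingleton _ _ (S.cross_of_crossAt hf) ⟨hf.2.1, hf.2.2.1⟩ ⟨hg.2.1, hg.2.2.1⟩

lemma isKPlanar_zero (h : ∀ k l, ¬ S.Cross k l) : S.toDrawing.IsKPlanar 0 := by
  intro e
  rw [Nat.cast_zero, nonpos_iff_eq_zero, Set.encard_eq_zero, Set.eq_empty_iff_forall_notMem]
  rintro p ⟨f, hf⟩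
  exact h _ _ (S.cross_of_crossAt hf)

end CurveSystem

/-! ### The sphere as a suspended circle -/

/-- The point of the unit circle at distance `θ` from a base point at `1 / 8`, when the length of
the circle is scaled to `n`. -/
noncomputable def circlePoint (n : ℕ) (θ : ℝ) : ℂ :=
  Complex.exp ((2 * Real.pi * (θ - 1 / 8) / n : ℝ) * Complex.I)

/-- The denominator of the chart `stripPoint`. It vanishes at the one point of the sphere that is
sent to infinity. -/
noncomputable def stripDen (n : ℕ) (θ η : ℝ) : ℂ :=
  (1 + η : ℝ) * circlePoint n θ - (7 * (1 - η) : ℝ)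

/-- The sphere, in coordinates: `θ` modulo `n` is the longitude, `η ∈ [-1, 1]` the latitude. The
point with coordinates `(θ, η)` is `(1 + η) / (1 - η) * circlePoint n θ` on the Riemann sphere, and
is mapped to the plane by `z ↦ 1 / (z - 7)`. Written as one fraction, the formula is valid
at both poles `η = ± 1`. The point sent to infinity has coordinates `(1 / 8, 3 / 4)`, as
`(1 + 3 / 4) / (1 - 3 / 4) = 7`. -/
noncomputable def stripPoint (n : ℕ) (θ η : ℝ) : Plane :=
  Complex.equivRealProdCLM ((1 - η : ℝ) / stripDen n θ η)

lemma norm_circlePoint (n : ℕ) (θ : ℝ) : ‖circlePoint n θ‖ = 1 :=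
  Complex.norm_exp_ofReal_mul_I _

lemma continuous_circlePoint (n : ℕ) : Continuous (circlePoint n) := by
  unfold circlePoint
  fun_prop

lemma circlePoint_eq_iff {n : ℕ} (hn : 0 < n) {θ θ' : ℝ} :
    circlePoint n θ = circlePoint n θ' ↔ ∃ m : ℤ, θ = θ' + m * n := by
  have hn' : (n : ℝ) ≠ 0 := by positivity
  have hpi := Real.pi_ne_zero
  unfold circlePoint
  rw [Complex.exp_eq_exp_iff_exists_int]
  refine exists_congr fun m => ?_
  have : ((2 * Real.pi * (θ' - 1 / 8) / n : ℝ) : ℂ) * Complex.I + m * (2 * Real.pi * Complex.I) =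
      ((2 * Real.pi * (θ' - 1 / 8) / n + m * (2 * Real.pi) : ℝ) : ℂ) * Complex.I := by
    push_cast; ring
  rw [this, mul_left_inj' Complex.I_ne_zero, Complex.ofReal_inj]
  field_simp
  constructor <;> intro h <;> linarith

lemma continuous_stripDen (n : ℕ) : Continuous fun p : ℝ × ℝ => stripDen n p.1 p.2 := by
  have := continuous_circlePoint n
  unfold stripDen
  fun_prop

lemma stripDen_eq_zero {n : ℕ} (hn : 0 < n) {θ η : ℝ} (h₁ : -1 ≤ η) (h₂ : η ≤ 1)
    (h : stripDen n θ η = 0) : η = 3 / 4 ∧ ∃ m : ℤ, θ = 1 / 8 + m * n := by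
  have h' := sub_eq_zero.1 h
  have hnorm := congrArg norm h'
  rw [norm_mul, norm_circlePoint, Complex.norm_real, Complex.norm_real, Real.norm_of_nonneg
    (by linarith), Real.norm_of_nonneg (by linarith)] at hnorm
  have hη : η = 3 / 4 := by linarith
  refine ⟨hη, (circlePoint_eq_iff hn).1 ?_⟩
  have hone : circlePoint n (1 / 8) = 1 := by simp [circlePoint]
  rw [hone]
  subst hη
  have : ((1 + 3 / 4 : ℝ) : ℂ) ≠ 0 := by norm_num
  apply mul_left_cancel₀ this
  rw [h']
  norm_num

lemma stripPoint_eq_iff_mul {n : ℕ} {θ η : ℝ} {w : Plane} (hd : stripDen n θ η ≠ 0) :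
    stripPoint n θ η = w ↔
      stripDen n θ η * Complex.equivRealProdCLM.symm w = (1 - η : ℝ) := by
  unfold stripPoint
  rw [ContinuousLinearEquiv.eq_symm_apply .. |>.symm, div_eq_iff hd, mul_comm, eq_comm]

lemma stripDen_ne_zero_of_mul_eq {n : ℕ} (hn : 0 < n) {θ η : ℝ} (h₁ : -1 ≤ η) (h₂ : η ≤ 1) {w : ℂ}
    (h : stripDen n θ η * w = (1 - η : ℝ)) : stripDen n θ η ≠ 0 := by
  intro h0
  obtain ⟨rfl, -⟩ := stripDen_eq_zero hn h₁ h₂ h0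
  rw [h0] at h
  norm_num at h

lemma continuousAt_stripPoint {n : ℕ} {p : ℝ × ℝ} (hd : stripDen n p.1 p.2 ≠ 0) :
    ContinuousAt (fun p : ℝ × ℝ => stripPoint n p.1 p.2) p := by
  unfold stripPoint
  have := (continuous_stripDen n).continuousAt (x := p)
  refine Complex.equivRealProdCLM.continuous.continuousAt.comp ?_
  exact ContinuousAt.div (by fun_prop) this hd

/-- Comparing absolute values recovers the latitude, and off the poles the quotient of the two points
of the Riemann sphere then recovers the longitude modulo `n`. -/
lemma stripPoint_eq_iff {n : ℕ} (hn : 0 < n) {θ η θ' η' : ℝ} (h₁ : -1 ≤ η) (h₂ : η ≤ 1)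
    (h₁' : -1 ≤ η') (h₂' : η' ≤ 1) (hd : stripDen n θ η ≠ 0) (hd' : stripDen n θ' η' ≠ 0) :
    stripPoint n θ η = stripPoint n θ' η' ↔
      η = η' ∧ (η = 1 ∨ η = -1 ∨ ∃ m : ℤ, θ = θ' + m * n) := by
  have key : stripPoint n θ η = stripPoint n θ' η' ↔
      ((1 - η) * (1 + η') : ℝ) * circlePoint n θ' = ((1 - η') * (1 + η) : ℝ) * circlePoint n θ := by
    unfold stripPoint
    rw [Complex.equivRealProdCLM.injective.eq_iff, div_eq_div_iff hd hd']
    unfold stripDen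
    push_cast
    constructor <;> intro h <;> linear_combination h
  rw [key, ← circlePoint_eq_iff hn]
  constructor
  · intro h
    have hnorm := congrArg norm h
    rw [norm_mul, norm_mul, norm_circlePoint, norm_circlePoint, Complex.norm_real,
      Complex.norm_real, Real.norm_of_nonneg (by nlinarith), Real.norm_of_nonneg (by nlinarith)]
      at hnorm
    have hη : η = η' := by linarith
    subst hη
    refine ⟨rfl, ?_⟩
    by_contra! hne
    apply hne.2.2
    have : (((1 - η) * (1 + η) : ℝ) : ℂ) ≠ 0 := by
      rw [Complex.ofReal_ne_zero]
      exact mul_ne_zero (sub_ne_zero.2 hne.1.symm) fun h => hne.2.1 (by linarith)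
    exact (mul_left_cancel₀ this h).symm
  · rintro ⟨rfl, rfl | rfl | h⟩
    · simp
    · simp
    · rw [h]

lemma exists_stripPoint_eq {n : ℕ} (hn : 0 < n) (w : Plane) :
    ∃ θ η : ℝ, -1 ≤ η ∧ η ≤ 1 ∧ stripDen n θ η ≠ 0 ∧ stripPoint n θ η = w := by
  suffices h : ∃ θ η : ℝ, -1 ≤ η ∧ η ≤ 1 ∧
      stripDen n θ η * Complex.equivRealProdCLM.symm w = (1 - η : ℝ) by
    obtain ⟨θ, η, h₁, h₂, h⟩ := h
    have hd := stripDen_ne_zero_of_mul_eq hn h₁ h₂ h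
    exact ⟨θ, η, h₁, h₂, hd, (stripPoint_eq_iff_mul hd).2 h⟩
  generalize Complex.equivRealProdCLM.symm w = u
  by_cases hu : u = 0
  · exact ⟨0, 1, by norm_num, le_rfl, by simp [hu]⟩
  have hn' : (n : ℝ) ≠ 0 := by positivity
  have hpi := Real.pi_ne_zero
  -- the point of the Riemann sphere that `z ↦ 1 / (z - 7)` sends to `u`, in polar coordinates
  set z : ℂ := 1 / u + 7 with hz
  have hr : 0 ≤ ‖z‖ := norm_nonneg z
  have hr' : 1 + ‖z‖ ≠ 0 := by positivity
  refine ⟨n * z.arg / (2 * Real.pi) + 1 / 8, (‖z‖ - 1) / (1 + ‖z‖), ?_, ?_, ?_⟩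
  · rw [le_div_iff₀ (by positivity)]; linarith
  · rw [div_le_iff₀ (by positivity)]; linarith
  have hc : circlePoint n (n * z.arg / (2 * Real.pi) + 1 / 8) = Complex.exp (z.arg * Complex.I) := by
    unfold circlePoint
    congr 3
    field_simp
    ring
  have e₁ : 1 + (‖z‖ - 1) / (1 + ‖z‖) = 2 / (1 + ‖z‖) * ‖z‖ := by field_simp; ring
  have e₂ : 1 - (‖z‖ - 1) / (1 + ‖z‖) = 2 / (1 + ‖z‖) := by field_simp; ring
  unfold stripDen
  rw [hc, e₁, e₂, Complex.ofReal_mul _ ‖z‖, mul_assoc, Complex.norm_mul_exp_arg_mul_I, hz]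
  push_cast
  field_simp
  ring

/-- The image of a compact set of coordinates is closed, even if it is unbounded: it is the
projection of a closed relation along a compact space. -/
lemma isClosed_stripPoint {n : ℕ} {C : Set (ℝ × ℝ)} (hC : IsCompact C) :
    IsClosed {w : Plane | ∃ p ∈ C,
      stripDen n p.1 p.2 * Complex.equivRealProdCLM.symm w = (1 - p.2 : ℝ)} := by
  have := isCompact_iff_compactSpace.1 hC
  have hden := continuous_stripDen n
  have hcl : IsClosed {q : C × Plane | stripDen n q.1.1.1 q.1.1.2 *
      Complex.equivRealProdCLM.symm q.2 = (1 - q.1.1.2 : ℝ)} := by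
    refine isClosed_eq ?_ (by fun_prop)
    refine Continuous.mul ?_ (by fun_prop)
    exact hden.comp (continuous_subtype_val.comp continuous_fst)
  convert isClosedMap_snd_of_compactSpace _ hcl using 1
  ext w
  constructor
  · rintro ⟨p, hp, h⟩
    exact ⟨(⟨p, hp⟩, w), h, rfl⟩
  · rintro ⟨⟨p, w⟩, h, rfl⟩
    exact ⟨p.1, p.2, h⟩

/-! ### Rectangular cells -/

/-- The latitude at distance `h` from the equator, in the half of the sphere given by `σ`. -/
def latitude (σ : Bool) (h : ℝ) : ℝ := if σ then h else -h

/-- The sphere is cut into `2 n` cells, each given by an arc of the equator and a pole. In the cell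
`F`, `x ∈ [0, 1]` is the position along the arc and `h ∈ [0, 1]` the distance from the
equator. -/
noncomputable def cellPoint {n : ℕ} (F : Fin n × Bool) (x h : ℝ) : Plane :=
  stripPoint n (F.1 + x) (latitude F.2 h)

/-- The coordinates `(x, h)` describe a point of the cell `F` other than the point of the sphere
that is sent to infinity. -/
def IsCellCoord {n : ℕ} (F : Fin n × Bool) (x h : ℝ) : Prop :=
  0 ≤ x ∧ x ≤ 1 ∧ 0 ≤ h ∧ h ≤ 1 ∧ ¬ (F.1.val = 0 ∧ F.2 = true ∧ x = 1 / 8 ∧ h = 3 / 4)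

/-- Coordinates `(x, h)` in `F` and `(y, k)` in `G` describe the same point of the sphere. -/
def Glued {n : ℕ} (F : Fin n × Bool) (x h : ℝ) (G : Fin n × Bool) (y k : ℝ) : Prop :=
  h = k ∧ ((h = 1 ∧ F.2 = G.2) ∨ (h = 0 ∨ F.2 = G.2) ∧
    ((F.1 = G.1 ∧ x = y) ∨ (x = 1 ∧ y = 0 ∧ G.1 = finRotate n F.1) ∨
      (x = 0 ∧ y = 1 ∧ F.1 = finRotate n G.1)))

lemma val_finRotate {n : ℕ} (i : Fin n) :
    (finRotate n i).val = if i.val + 1 = n then 0 else i.val + 1 := by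
  obtain _ | n := n
  · exact i.elim0
  · rw [coe_finRotate]
    simp [Fin.ext_iff]

lemma latitude_mem {σ : Bool} {h : ℝ} (h₀ : 0 ≤ h) (h₁ : h ≤ 1) :
    -1 ≤ latitude σ h ∧ latitude σ h ≤ 1 := by
  unfold latitude
  split_ifs <;> constructor <;> linarith

lemma stripDen_cell_ne_zero {n : ℕ} {F : Fin n × Bool} {x h : ℝ} (hc : IsCellCoord F x h) :
    stripDen n (F.1 + x) (latitude F.2 h) ≠ 0 := by
  obtain ⟨hx₀, hx₁, hh₀, hh₁, hp⟩ := hc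
  intro h0
  have hn := F.1.pos
  obtain ⟨hη, m, hm⟩ :=
    stripDen_eq_zero hn (latitude_mem hh₀ hh₁).1 (latitude_mem hh₀ hh₁).2 h0
  have hi : (F.1.val : ℝ) + 1 ≤ n := by exact_mod_cast F.1.isLt
  have hi₀ : (0 : ℝ) ≤ F.1.val := by positivity
  have hnR : (0 : ℝ) < n := by exact_mod_cast hn
  have hm0 : m = 0 := by
    have h₁ : (-1 : ℝ) < m := by
      by_contra! hcon
      nlinarith
    have h₂ : (m : ℝ) < 1 := by
      by_contra! hcon
      nlinarith
    have h₁' : -1 < m := by exact_mod_cast h₁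
    have h₂' : m < 1 := by exact_mod_cast h₂
    omega
  rw [hm0, Int.cast_zero, zero_mul, add_zero] at hm
  have hi0 : F.1.val = 0 := by
    by_contra hne
    have : (1 : ℝ) ≤ F.1.val := by exact_mod_cast Nat.one_le_iff_ne_zero.2 hne
    linarith
  rw [hi0, Nat.cast_zero, zero_add] at hm
  unfold latitude at hη
  split_ifs at hη with hσ
  · exact hp ⟨hi0, hσ, hm, hη⟩
  · linarith

lemma cellPoint_eq_iff {n : ℕ} {F G : Fin n × Bool} {x h y k : ℝ} (hF : IsCellCoord F x h)
    (hG : IsCellCoord G y k) : cellPoint F x h = cellPoint G y k ↔ Glued F x h G y k := by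
  have hdF := stripDen_cell_ne_zero hF
  have hdG := stripDen_cell_ne_zero hG
  obtain ⟨hx₀, hx₁, hh₀, hh₁, -⟩ := hF
  obtain ⟨hy₀, hy₁, hk₀, hk₁, -⟩ := hG
  have hn := F.1.pos
  unfold cellPoint
  rw [stripPoint_eq_iff hn (latitude_mem hh₀ hh₁).1 (latitude_mem hh₀ hh₁).2
    (latitude_mem hk₀ hk₁).1 (latitude_mem hk₀ hk₁).2 hdF hdG]
  have hlat : latitude F.2 h = latitude G.2 k ↔ h = k ∧ (h = 0 ∨ F.2 = G.2) := by
    rcases F with ⟨i, _ | _⟩ <;> rcases G with ⟨j, _ | _⟩ <;> simp only [latitude] <;> grind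
  have hlon : (∃ m : ℤ, (F.1.val + x : ℝ) = G.1.val + y + m * n) ↔
      ((F.1 = G.1 ∧ x = y) ∨ (x = 1 ∧ y = 0 ∧ G.1 = finRotate n F.1) ∨
      (x = 0 ∧ y = 1 ∧ F.1 = finRotate n G.1)) := by
    have hi := F.1.isLt
    have hj := G.1.isLt
    have hRF := val_finRotate F.1
    have hRG := val_finRotate G.1
    have hnR : (0 : ℝ) < n := by exact_mod_cast hn
    constructor
    · rintro ⟨m, hm⟩
      -- the difference of the two positions inside the arcs is an integer
      obtain ⟨d, hd⟩ : ∃ d : ℤ, d = G.1.val - F.1.val + m * n := ⟨_, rfl⟩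
      have hdR : (d : ℝ) = x - y := by rw [hd]; push_cast; linarith
      have hd₁ : -1 ≤ d := by
        have : (-1 : ℝ) ≤ d := by linarith
        exact_mod_cast this
      have hd₂ : d ≤ 1 := by
        have : (d : ℝ) ≤ 1 := by linarith
        exact_mod_cast this
      have hm₁ : -1 ≤ m := by nlinarith
      have hm₂ : m ≤ 1 := by nlinarith
      have hdc : d = -1 ∨ d = 0 ∨ d = 1 := by omega
      have hmc : m = -1 ∨ m = 0 ∨ m = 1 := by omega
      rcases hdc with h | h | h
      · right; right
        rw [h] at hdR
        push_cast at hdR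
        refine ⟨by linarith, by linarith, Fin.ext ?_⟩
        rw [hRG]
        rcases hmc with rfl | rfl | rfl <;> split_ifs <;> omega
      · left
        rw [h] at hdR
        push_cast at hdR
        refine ⟨Fin.ext ?_, by linarith⟩
        rcases hmc with rfl | rfl | rfl <;> omega
      · right; left
        rw [h] at hdR
        push_cast at hdR
        refine ⟨by linarith, by linarith, Fin.ext ?_⟩
        rw [hRF]
        rcases hmc with rfl | rfl | rfl <;> split_ifs <;> omega
    · rintro (⟨h, rfl⟩ | ⟨rfl, rfl, h⟩ | ⟨rfl, rfl, h⟩)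
      · exact ⟨0, by rw [h]; simp⟩
      · rw [h, hRF]
        split_ifs with h'
        · have hR : (F.1.val : ℝ) + 1 = n := by exact_mod_cast h'
          exact ⟨1, by push_cast; linarith⟩
        · exact ⟨0, by push_cast; ring⟩
      · rw [h, hRG]
        split_ifs with h'
        · have hR : (G.1.val : ℝ) + 1 = n := by exact_mod_cast h'
          exact ⟨-1, by push_cast; linarith⟩
        · exact ⟨0, by push_cast; ring⟩
  have hpole : (latitude F.2 h = 1 ∨ latitude F.2 h = -1) ↔ h = 1 := by
    rcases F with ⟨i, _ | _⟩ <;> simp only [latitude] <;> grind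
  rw [hlon, ← or_assoc, hpole, hlat]
  unfold Glued
  grind

lemma exists_cellPoint_eq {n : ℕ} (hn : 0 < n) (w : Plane) :
    ∃ (F : Fin n × Bool) (x h : ℝ), IsCellCoord F x h ∧ cellPoint F x h = w := by
  obtain ⟨θ, η, h₁, h₂, hd, rfl⟩ := exists_stripPoint_eq hn w
  have hnR : (0 : ℝ) < n := by exact_mod_cast hn
  -- reduce the longitude modulo `n`
  obtain ⟨m, θ', hθ, h₀, hlt⟩ : ∃ (m : ℤ) (θ' : ℝ), θ' = θ + m * n ∧ 0 ≤ θ' ∧ θ' < n := by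
    refine ⟨-⌊θ / n⌋, _, rfl, ?_, ?_⟩
    · have := Int.floor_le (θ / n)
      rw [le_div_iff₀ hnR] at this
      push_cast
      linarith
    · have := Int.lt_floor_add_one (θ / n)
      rw [div_lt_iff₀ hnR] at this
      push_cast
      linarith
  have hfl : ⌊θ'⌋₊ < n := (Nat.floor_lt h₀).2 hlt
  have hcirc : circlePoint n θ' = circlePoint n θ := (circlePoint_eq_iff hn).2 ⟨m, hθ⟩
  obtain ⟨σ, h, hh₀, hh₁, hσ⟩ : ∃ (σ : Bool) (h : ℝ), 0 ≤ h ∧ h ≤ 1 ∧ latitude σ h = η := by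
    rcases le_total 0 η with hη | hη
    · exact ⟨true, η, hη, h₂, rfl⟩
    · exact ⟨false, -η, by linarith, by linarith, by simp [latitude]⟩
  have hlon : ((⌊θ'⌋₊ : ℝ) + (θ' - ⌊θ'⌋₊)) = θ' := by ring
  refine ⟨(⟨⌊θ'⌋₊, hfl⟩, σ), θ' - ⌊θ'⌋₊, h, ⟨?_, ?_, hh₀, hh₁, ?_⟩, ?_⟩
  · linarith [Nat.floor_le h₀]
  · linarith [Nat.lt_floor_add_one θ']
  · rintro ⟨hi, rfl, hx, rfl⟩
    apply hd
    simp only at hi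
    rw [hi] at hx
    have hθ' : θ' = 1 / 8 := by simpa using hx
    have hone : circlePoint n (1 / 8) = 1 := by simp [circlePoint]
    have hη : η = 3 / 4 := by rw [← hσ]; rfl
    rw [stripDen, ← hcirc, hθ', hone, hη]
    norm_num
  · unfold cellPoint
    simp only
    rw [hlon, hσ]
    simp only [stripPoint, stripDen, hcirc]

lemma continuousAt_cellPoint {n : ℕ} {F : Fin n × Bool} {p : ℝ × ℝ} (hp : IsCellCoord F p.1 p.2) :
    ContinuousAt (fun p : ℝ × ℝ => cellPoint F p.1 p.2) p := by
  have hl : Continuous (latitude F.2) := by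
    unfold latitude
    split_ifs <;> fun_prop
  have hg : Continuous fun p : ℝ × ℝ => ((F.1.val : ℝ) + p.1, latitude F.2 p.2) := by fun_prop
  exact ContinuousAt.comp (f := fun p : ℝ × ℝ => ((F.1.val : ℝ) + p.1, latitude F.2 p.2))
    (continuousAt_stripPoint (n := n) (stripDen_cell_ne_zero hp)) hg.continuousAt

/-- The part of the plane described by a set `C` of coordinates in the cell `F`. -/
def cellImage {n : ℕ} (F : Fin n × Bool) (C : Set (ℝ × ℝ)) : Set Plane :=
  {w | ∃ x h, (x, h) ∈ C ∧ IsCellCoord F x h ∧ cellPoint F x h = w}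

lemma isClosed_cellImage {n : ℕ} (F : Fin n × Bool) {C : Set (ℝ × ℝ)} (hC : IsClosed C) :
    IsClosed (cellImage F C) := by
  have hl : Continuous (latitude F.2) := by
    unfold latitude
    split_ifs <;> fun_prop
  have hg : Continuous fun p : ℝ × ℝ => ((F.1.val : ℝ) + p.1, latitude F.2 p.2) := by fun_prop
  have hK : IsCompact (C ∩ Set.Icc (0 : ℝ) 1 ×ˢ Set.Icc (0 : ℝ) 1) :=
    (isCompact_Icc.prod isCompact_Icc).inter_left hC
  convert isClosed_stripPoint (n := n) (hK.image hg) using 1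
  ext w
  constructor
  · rintro ⟨x, h, hxh, hc, hw⟩
    refine ⟨_, ⟨(x, h), ⟨hxh, ⟨hc.1, hc.2.1⟩, hc.2.2.1, hc.2.2.2.1⟩, rfl⟩, ?_⟩
    exact (stripPoint_eq_iff_mul (stripDen_cell_ne_zero hc)).1 hw
  · rintro ⟨_, ⟨⟨x, h⟩, ⟨hxh, ⟨hx₀, hx₁⟩, hh₀, hh₁⟩, rfl⟩, hw⟩
    have hd := stripDen_ne_zero_of_mul_eq F.1.pos (latitude_mem hh₀ hh₁).1
      (latitude_mem hh₀ hh₁).2 hw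
    refine ⟨x, h, hxh, ⟨hx₀, hx₁, hh₀, hh₁, ?_⟩, (stripPoint_eq_iff_mul hd).2 hw⟩
    rintro ⟨hi, hσ, rfl, rfl⟩
    apply hd
    have hone : circlePoint n (1 / 8) = 1 := by simp [circlePoint]
    simp only [hi, hσ, latitude, stripDen]
    rw [Nat.cast_zero, zero_add, hone]
    norm_num

/-- The open cell is an open part of the plane, and so is each of its open parts: the complement is
the union of the closed cells but one and a closed part of the last one. -/
lemma isOpen_cellImage {n : ℕ} (F : Fin n × Bool) {U : Set (ℝ × ℝ)} (hU : IsOpen U)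
    (hU' : U ⊆ Set.Ioo (0 : ℝ) 1 ×ˢ Set.Ioo (0 : ℝ) 1) : IsOpen (cellImage F U) := by
  have hcl : IsClosed ((⋃ G ∈ {G : Fin n × Bool | G ≠ F}, cellImage G Set.univ) ∪
      cellImage F Uᶜ) :=
    (Set.Finite.isClosed_biUnion (Set.toFinite _)
      fun G _ => isClosed_cellImage G isClosed_univ).union (isClosed_cellImage F hU.isClosed_compl)
  rw [← isClosed_compl_iff]
  convert hcl using 1
  ext w
  constructor
  · intro hw
    obtain ⟨G, x, h, hc, rfl⟩ := exists_cellPoint_eq F.1.pos w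
    by_cases hG : G = F
    · subst hG
      exact .inr ⟨x, h, fun hxh => hw ⟨x, h, hxh, hc, rfl⟩, hc, rfl⟩
    · exact .inl (Set.mem_biUnion (show G ∈ {G | G ≠ F} from hG) ⟨x, h, trivial, hc, rfl⟩)
  · rintro hw ⟨y, k, hyk, hc', rfl⟩
    have hU'' := hU' hyk
    simp only [Set.mem_prod, Set.mem_Ioo] at hU''
    rcases hw with hw | ⟨x, h, hxh, hc, hw⟩
    · obtain ⟨G, hG, x, h, -, hc, hw⟩ := Set.mem_iUnion₂.1 hw
      rw [cellPoint_eq_iff hc hc'] at hw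
      have hG' : G ≠ F := hG
      have : ¬ (G.1 = F.1 ∧ G.2 = F.2) := fun h => hG' (Prod.ext h.1 h.2)
      unfold Glued at hw
      grind
    · rw [cellPoint_eq_iff hc hc'] at hw
      have : (x, h) ≠ (y, k) := fun he => hxh (he ▸ hyk)
      unfold Glued at hw
      grind

/-! ### Proper crossings inside a cell -/

lemma ProperlyCrossAt.symm {A B : Set Plane} {p : Plane} (h : ProperlyCrossAt A B p) :
    ProperlyCrossAt B A p := by
  obtain ⟨e, hp, h0, he⟩ := h
  refine ⟨e.transHomeomorph (Homeomorph.prodComm ℝ ℝ), hp, ?_, fun q hq => ?_⟩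
  · simp only [OpenPartialHomeomorph.transHomeomorph_apply, Function.comp_apply, h0]
    rfl
  · exact (he q hq).symm

/-- An open part of the open cell that avoids the point at infinity is a chart of the plane. -/
lemma exists_cellChart {n : ℕ} (F : Fin n × Bool) {U : Set (ℝ × ℝ)} (hU : IsOpen U)
    (hU' : U ⊆ Set.Ioo (0 : ℝ) 1 ×ˢ Set.Ioo (0 : ℝ) 1)
    (hc : ∀ p ∈ U, IsCellCoord F p.1 p.2) :
    ∃ e : OpenPartialHomeomorph Plane Plane, e.source = U ∧
      ∀ p, e p = cellPoint F p.1 p.2 := by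
  have hinj : Set.InjOn (fun p : Plane => cellPoint F p.1 p.2) U := by
    rintro ⟨x, h⟩ hp ⟨y, k⟩ hq hpq
    have hg := (cellPoint_eq_iff (hc _ hp) (hc _ hq)).1 hpq
    have h₁ := hU' hp
    have h₂ := hU' hq
    simp only [Set.mem_prod, Set.mem_Ioo] at h₁ h₂
    unfold Glued at hg
    grind
  have hb := hinj.bijOn_image
  refine ⟨OpenPartialHomeomorph.ofContinuousOpenRestrict (hb.toPartialEquiv _ _ _)
    (fun p hp => (continuousAt_cellPoint (hc p hp)).continuousWithinAt) ?_ hU, rfl, fun p => rfl⟩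
  intro W hW
  have hW' := hU.isOpenMap_subtype_val W hW
  have hsub : Subtype.val '' W ⊆ U := by
    rintro _ ⟨p, -, rfl⟩
    exact p.2
  convert isOpen_cellImage F hW' (hsub.trans hU') using 1
  ext w
  constructor
  · rintro ⟨p, hp, rfl⟩
    exact ⟨p.1.1, p.1.2, ⟨p, hp, rfl⟩, hc _ p.2, rfl⟩
  · rintro ⟨x, h, ⟨p, hp, hxh⟩, -, rfl⟩
    refine ⟨p, hp, ?_⟩
    change cellPoint F p.1.1 p.1.2 = _
    rw [hxh]

lemma ne_finRotate {n : ℕ} (hn : 2 ≤ n) (i : Fin n) : i ≠ finRotate n i := by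
  have hi := val_finRotate i
  rw [Ne, Fin.ext_iff]
  split_ifs at hi <;> omega

lemma Glued.eq_of_inner {n : ℕ} {F G : Fin n × Bool} {x h y k : ℝ} (hg : Glued F x h G y k)
    (hx₀ : 0 < x) (hx₁ : x < 1) (hh₀ : 0 < h) (hh₁ : h < 1) : F = G ∧ x = y ∧ h = k := by
  have hFG : F.1 = G.1 → F.2 = G.2 → F = G := Prod.ext
  unfold Glued at hg
  grind

lemma Glued.eq_of_base {n : ℕ} {F G : Fin n × Bool} {x y k : ℝ} (hg : Glued F x 0 G y k)
    (hx₀ : 0 < x) (hx₁ : x < 1) : F.1 = G.1 ∧ x = y ∧ k = 0 := by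
  unfold Glued at hg
  grind

lemma Glued.eq_of_side {n : ℕ} {F G : Fin n × Bool} {h k : ℝ} (hg : Glued F 0 h G 0 k)
    (hh₀ : 0 < h) (hh₁ : h < 1) : F = G ∧ h = k := by
  have hFG : F.1 = G.1 → F.2 = G.2 → F = G := Prod.ext
  unfold Glued at hg
  grind

lemma Glued.symm {n : ℕ} {F G : Fin n × Bool} {x h y k : ℝ} (hg : Glued F x h G y k) :
    Glued G y k F x h := by
  unfold Glued at hg ⊢
  grind

/-! ### The curves inside the cells -/

/-- The kinds of edges that are drawn in a cell: `base` and `side` are the base-edge and the edge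
from the first base-vertex to the apex of the bipyramid, `toApex`, `toLeft`, `toRight` are the edges
of the new vertex, and `paired` is the re-routed apex-edge. -/
inductive Shape
  | base
  | side
  | toApex
  | toLeft
  | toRight
  | paired

namespace Shape

/-- Each kind of edge is a straight segment in the coordinates of the cell. The new vertex lies at
`(1 / 4, 3 / 4)`, and the segments `paired` and `toRight` cross at `(1 / 3, 2 / 3)`. -/
noncomputable def coord : Shape → ℝ → ℝ × ℝ
  | base, t => (t, 0)
  | side, t => (0, t)
  | toApex, t => (1 / 4, 3 / 4 + t / 4)
  | toLeft, t => (t / 4, 3 * t / 4)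
  | toRight, t => (1 / 4 + 3 * t / 4, 3 / 4 - 3 * t / 4)
  | paired, t => (t / 2, t)

lemma continuous_coord (k : Shape) : Continuous k.coord := by
  cases k <;> unfold coord <;> fun_prop

lemma isCellCoord_coord {n : ℕ} (F : Fin n × Bool) (k : Shape) {t : ℝ} (h₀ : 0 ≤ t) (h₁ : t ≤ 1) :
    IsCellCoord F (k.coord t).1 (k.coord t).2 := by
  cases k <;>
    exact ⟨by simp only [coord]; linarith, by simp only [coord]; linarith,
      by simp only [coord]; linarith, by simp only [coord]; linarith,
      fun h => by have h₁ := h.2.2.1; have h₂ := h.2.2.2; simp only [coord] at h₁ h₂; linarith⟩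

/-- The curve of a given kind in a given cell. -/
noncomputable def curve {n : ℕ} (F : Fin n × Bool) (k : Shape) : C(unitInterval, Plane) where
  toFun t := cellPoint F (k.coord t).1 (k.coord t).2
  continuous_toFun := by
    rw [continuous_iff_continuousAt]
    intro t
    exact ContinuousAt.comp (f := fun t : unitInterval => k.coord t)
      (continuousAt_cellPoint (k.isCellCoord_coord F t.2.1 t.2.2))
      (k.continuous_coord.comp continuous_subtype_val).continuousAt

lemma curve_apply {n : ℕ} (F : Fin n × Bool) (k : Shape) (t : unitInterval) :
    curve F k t = cellPoint F (k.coord t).1 (k.coord t).2 := rfl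

lemma curve_eq_curve_iff {n : ℕ} {F G : Fin n × Bool} {k l : Shape} {t u : unitInterval} :
    curve F k t = curve G l u ↔
      Glued F (k.coord t).1 (k.coord t).2 G (l.coord u).1 (l.coord u).2 :=
  cellPoint_eq_iff (k.isCellCoord_coord F t.2.1 t.2.2) (l.isCellCoord_coord G u.2.1 u.2.2)

lemma curve_injective {n : ℕ} (hn : 2 ≤ n) (F : Fin n × Bool) (k : Shape) :
    Function.Injective (curve F k) := by
  intro t u h
  rw [curve_eq_curve_iff] at h
  apply Subtype.ext
  have hne := ne_finRotate hn F.1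
  obtain ⟨h₁, ⟨h₂, -⟩ | ⟨-, ⟨-, h₂⟩ | ⟨-, -, h₂⟩ | ⟨-, -, h₂⟩⟩⟩ := h
  · cases k <;> simp only [coord] at h₁ h₂ <;> linarith
  · cases k <;> simp only [coord] at h₁ h₂ <;> linarith
  · exact absurd h₂ hne
  · exact absurd h₂ hne

lemma coord_mem_Ioo {k : Shape} (hk : k ≠ side) (hk' : k ≠ base) {t : ℝ} (h₀ : 0 < t) (h₁ : t < 1) :
    0 < (k.coord t).1 ∧ (k.coord t).1 < 1 ∧ 0 < (k.coord t).2 ∧ (k.coord t).2 < 1 := by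
  cases k <;> simp only [ne_eq, not_true_eq_false] at hk hk' <;>
    exact ⟨by simp only [coord]; linarith, by simp only [coord]; linarith,
      by simp only [coord]; linarith, by simp only [coord]; linarith⟩

/-- Inner points of two distinct segments in a drawing of the bipyramid with inserted vertices are
identified only if the segments are the crossing pair of a cell. -/
lemma crossing_pair_of_meet {n : ℕ} {F G : Fin n × Bool} {k l : Shape} {t u : ℝ}
    (ht₀ : 0 < t) (ht₁ : t < 1) (hu₀ : 0 < u) (hu₁ : u < 1) (hk : k ≠ side) (hl : l ≠ side)
    (hF : k = base → F.2 = true) (hG : l = base → G.2 = true) (hne : (F, k) ≠ (G, l))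
    (h : Glued F (k.coord t).1 (k.coord t).2 G (l.coord u).1 (l.coord u).2) :
    F = G ∧ (k = paired ∧ l = toRight ∨ k = toRight ∧ l = paired) := by
  by_cases hkb : k = base
  · subst hkb
    obtain ⟨h₁, h₂, h₃⟩ := h.eq_of_base ht₀ ht₁
    by_cases hlb : l = base
    · subst hlb
      exact (hne (Prod.ext (Prod.ext h₁ ((hF rfl).trans (hG rfl).symm)) rfl)).elim
    · exact absurd h₃ (coord_mem_Ioo hl hlb hu₀ hu₁).2.2.1.ne'
  · obtain ⟨a₁, a₂, a₃, a₄⟩ := coord_mem_Ioo hk hkb ht₀ ht₁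
    obtain ⟨rfl, h₂, h₃⟩ := h.eq_of_inner a₁ a₂ a₃ a₄
    have hkl : k ≠ l := fun h => hne (by rw [h])
    refine ⟨rfl, ?_⟩
    cases k <;> cases l <;> simp only [coord, ne_eq, not_true_eq_false] at h₂ h₃ hkl hkb hk hl <;>
      first | linarith | exact .inl ⟨rfl, rfl⟩ | exact .inr ⟨rfl, rfl⟩

lemma eq_of_meet {n : ℕ} {F G : Fin n × Bool} {k l : Shape} {t u : ℝ}
    (ht₀ : 0 < t) (ht₁ : t < 1) (hu₀ : 0 < u) (hu₁ : u < 1) (hk : k = side ∨ k = base ∧ F.2 = true)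
    (hl : l = side ∨ l = base ∧ G.2 = true)
    (h : Glued F (k.coord t).1 (k.coord t).2 G (l.coord u).1 (l.coord u).2) :
    (F, k) = (G, l) := by
  rcases hk with rfl | ⟨rfl, hF⟩ <;> rcases hl with rfl | ⟨rfl, hG⟩
  · rw [(h.eq_of_side ht₀ ht₁).1]
  · exact absurd (h.symm.eq_of_base hu₀ hu₁).2.1 hu₀.ne'
  · exact absurd (h.eq_of_base ht₀ ht₁).2.1 ht₀.ne'
  · rw [Prod.ext (h.eq_of_base ht₀ ht₁).1 (hF.trans hG.symm)]

lemma eq_crossing {n : ℕ} (hn : 2 ≤ n) {F : Fin n × Bool} {p : Plane}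
    (h : p ∈ Set.range (curve F paired)) (h' : p ∈ Set.range (curve F toRight)) : p = cellPoint F (1 / 3) (2 / 3) := by
  obtain ⟨t, rfl⟩ := h
  obtain ⟨u, hu⟩ := h'
  have ht := t.2
  have hu' := u.2
  simp only [Set.mem_Icc] at ht hu'
  rw [curve_eq_curve_iff] at hu
  rw [curve_apply]
  have ht' : (t : ℝ) = 2 / 3 := by
    obtain ⟨h₁, ⟨h₂, -⟩ | ⟨-, ⟨-, h₂⟩ | ⟨-, -, h₂⟩ | ⟨-, -, h₂⟩⟩⟩ := hu
    · simp only [coord] at h₁ h₂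
      linarith
    · simp only [coord] at h₁ h₂
      linarith
    · exact absurd h₂ (ne_finRotate hn F.1)
    · exact absurd h₂ (ne_finRotate hn F.1)
  simp only [coord, ht']
  norm_num

lemma crossing_mem_paired {n : ℕ} (F : Fin n × Bool) :
    cellPoint F (1 / 3) (2 / 3) ∈ Set.range (curve F paired) :=
  ⟨⟨2 / 3, by norm_num, by norm_num⟩, by rw [curve_apply]; norm_num [coord]⟩

lemma crossing_mem_toRight {n : ℕ} (F : Fin n × Bool) :
    cellPoint F (1 / 3) (2 / 3) ∈ Set.range (curve F toRight) :=
  ⟨⟨1 / 9, by norm_num, by norm_num⟩, by rw [curve_apply]; norm_num [coord]⟩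

/-- The linear coordinates in which the lines of `paired` and `toRight` are the axes. -/
noncomputable def crossingCoord : (ℝ × ℝ) ≃ₜ (ℝ × ℝ) where
  toFun p := (p.2 + p.1 - 1, p.2 - 2 * p.1)
  invFun q := ((q.1 - q.2 + 1) / 3, (2 * (q.1 + 1) + q.2) / 3)
  left_inv p := by ext <;> simp only <;> ring
  right_inv p := by ext <;> simp only <;> ring
  continuous_toFun := by fun_prop
  continuous_invFun := by fun_prop

lemma properlyCrossAt {n : ℕ} (hn : 2 ≤ n) {F : Fin n × Bool} {p : Plane}
    (h : p ∈ Set.range (curve F paired)) (h' : p ∈ Set.range (curve F toRight)) :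
    ProperlyCrossAt (Set.range (curve F paired)) (Set.range (curve F toRight)) p := by
  obtain rfl := eq_crossing hn h h'
  -- right of the new vertex, `toRight` is all of its line
  have hco : ∀ q ∈ Set.Ioo (1 / 4 : ℝ) 1 ×ˢ Set.Ioo (0 : ℝ) 1, IsCellCoord F q.1 q.2 := by
    rintro ⟨x, h⟩ hq
    simp only [Set.mem_prod, Set.mem_Ioo] at hq
    exact ⟨by linarith, hq.1.2.le, hq.2.1.le, hq.2.2.le, fun h => by linarith [hq.1.1, h.2.2.1]⟩
  obtain ⟨e, hsrc, he⟩ := exists_cellChart F (isOpen_Ioo.prod isOpen_Ioo)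
    (Set.prod_mono (Set.Ioo_subset_Ioo_left (by norm_num)) le_rfl) hco
  have hmem : ((1 / 3, 2 / 3) : ℝ × ℝ) ∈ e.source := by
    rw [hsrc]; norm_num
  have hp : cellPoint F (1 / 3) (2 / 3) = e (1 / 3, 2 / 3) := (he (1 / 3, 2 / 3)).symm
  refine ⟨e.symm.transHomeomorph crossingCoord, ?_, ?_, ?_⟩
  · rw [hp]; exact e.map_source hmem
  · rw [hp]
    simp only [OpenPartialHomeomorph.transHomeomorph_apply, Function.comp_apply]
    rw [e.left_inv hmem]
    change ((2 / 3 + 1 / 3 - 1, 2 / 3 - 2 * (1 / 3)) : ℝ × ℝ) = 0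
    norm_num
  · intro q hq
    obtain ⟨⟨x, h⟩, hxh, rfl⟩ : ∃ r ∈ e.source, e r = q :=
      ⟨e.symm q, e.map_target hq, e.right_inv hq⟩
    simp only [OpenPartialHomeomorph.transHomeomorph_apply, Function.comp_apply]
    rw [e.left_inv hxh, he]
    rw [hsrc] at hxh
    have hc : IsCellCoord F x h := hco _ hxh
    simp only [Set.mem_prod, Set.mem_Ioo] at hxh
    change (_ ↔ h - 2 * x = 0) ∧ (_ ↔ h + x - 1 = 0)
    constructor
    · constructor
      · rintro ⟨t, ht⟩
        rw [curve_apply, cellPoint_eq_iff (isCellCoord_coord F _ t.2.1 t.2.2) hc] at ht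
        obtain ⟨-, h₁, h₂⟩ := ht.symm.eq_of_inner (by linarith) hxh.1.2 hxh.2.1 hxh.2.2
        simp only [coord] at h₁ h₂
        linarith
      · intro hl
        refine ⟨⟨h, hxh.2.1.le, hxh.2.2.le⟩, ?_⟩
        rw [curve_apply]
        simp only [coord]
        congr 1
        linarith
    · constructor
      · rintro ⟨t, ht⟩
        rw [curve_apply, cellPoint_eq_iff (isCellCoord_coord F _ t.2.1 t.2.2) hc] at ht
        obtain ⟨-, h₁, h₂⟩ := ht.symm.eq_of_inner (by linarith) hxh.1.2 hxh.2.1 hxh.2.2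
        simp only [coord] at h₁ h₂
        linarith
      · intro hl
        refine ⟨⟨(4 * x - 1) / 3, by linarith, by linarith⟩, ?_⟩
        rw [curve_apply]
        simp only [coord]
        congr 1 <;> linarith

end Shape

/-! ### The two drawings -/

lemma cycleGraph_adj_iff_finRotate {n : ℕ} (hn : 2 ≤ n) {i j : Fin n} :
    (SimpleGraph.cycleGraph n).Adj i j ↔ j = finRotate n i ∨ i = finRotate n j := by
  have hi := val_finRotate i
  have hj := val_finRotate j
  rw [SimpleGraph.cycleGraph_adj', Fin.ext_iff, Fin.ext_iff, hi, hj]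
  have h₁ := i.isLt
  have h₂ := j.isLt
  rcases le_total i j with h | h
  · rcases h.eq_or_lt with rfl | h'
    · rw [Fin.sub_val_of_le le_rfl]
      split_ifs <;> omega
    · rw [Fin.sub_val_of_le h, Fin.coe_sub_iff_lt.2 h']
      rw [Fin.lt_def] at h'
      split_ifs <;> omega
  · rcases h.eq_or_lt with rfl | h'
    · rw [Fin.sub_val_of_le le_rfl]
      split_ifs <;> omega
    · rw [Fin.sub_val_of_le h, Fin.coe_sub_iff_lt.2 h']
      rw [Fin.lt_def] at h'
      split_ifs <;> omega

section Drawings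

variable {s : ℕ} (hs : 8 ≤ s)

/-- The points of the vertices. The first base-vertex of a cell is its corner `(0, 0)`, its side
`h = 1` is collapsed to the apex, and the new vertex is at `(1 / 4, 3 / 4)`. -/
noncomputable def vertexPoint : BipyramidVertex s ⊕ BipyramidFace s → Plane
  | .inl (.inl i) => cellPoint (i, true) 0 0
  | .inl (.inr σ) => cellPoint ((⟨0, by omega⟩ : Fin (s - 2)), σ) 0 1
  | .inr F => cellPoint F (1 / 4) (3 / 4)

lemma isCellCoord_side {n : ℕ} (F : Fin n × Bool) {h : ℝ} (h₀ : 0 ≤ h) (h₁ : h ≤ 1) :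
    IsCellCoord F 0 h :=
  ⟨le_rfl, zero_le_one, h₀, h₁, fun h => by norm_num at h⟩

lemma isCellCoord_right_side {n : ℕ} (F : Fin n × Bool) {h : ℝ} (h₀ : 0 ≤ h) (h₁ : h ≤ 1) :
    IsCellCoord F 1 h :=
  ⟨zero_le_one, le_rfl, h₀, h₁, fun h => by norm_num at h⟩

lemma isCellCoord_base {n : ℕ} (F : Fin n × Bool) {x : ℝ} (h₀ : 0 ≤ x) (h₁ : x ≤ 1) :
    IsCellCoord F x 0 :=
  ⟨h₀, h₁, le_rfl, zero_le_one, fun h => by norm_num at h⟩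

lemma isCellCoord_apex {n : ℕ} (F : Fin n × Bool) {x : ℝ} (h₀ : 0 ≤ x) (h₁ : x ≤ 1) :
    IsCellCoord F x 1 :=
  ⟨h₀, h₁, zero_le_one, le_rfl, fun h => by norm_num at h⟩

lemma isCellCoord_new {n : ℕ} (F : Fin n × Bool) : IsCellCoord F (1 / 4) (3 / 4) := by
  unfold IsCellCoord; norm_num

lemma cellPoint_left (F : BipyramidFace s) : cellPoint F 0 0 = vertexPoint hs (.inl F.left) :=
  (cellPoint_eq_iff (isCellCoord_base _ le_rfl zero_le_one)
    (isCellCoord_base _ le_rfl zero_le_one)).2 ⟨rfl, .inr ⟨.inl rfl, .inl ⟨rfl, rfl⟩⟩⟩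

lemma cellPoint_right (F : BipyramidFace s) : cellPoint F 1 0 = vertexPoint hs (.inl F.right) :=
  (cellPoint_eq_iff (isCellCoord_base _ zero_le_one le_rfl)
    (isCellCoord_base _ le_rfl zero_le_one)).2 ⟨rfl, .inr ⟨.inl rfl, .inr (.inl ⟨rfl, rfl, rfl⟩)⟩⟩

lemma cellPoint_apex (F : BipyramidFace s) {x : ℝ} (h₀ : 0 ≤ x) (h₁ : x ≤ 1) :
    cellPoint F x 1 = vertexPoint hs (.inl F.apex) :=
  (cellPoint_eq_iff (isCellCoord_apex _ h₀ h₁) (isCellCoord_apex _ le_rfl zero_le_one)).2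
    ⟨rfl, .inl ⟨rfl, rfl⟩⟩

lemma vertexPoint_injective : Function.Injective (vertexPoint hs) := by
  have h0 : ∀ F : BipyramidFace s, IsCellCoord F 0 0 := fun F =>
    isCellCoord_base _ le_rfl zero_le_one
  have h1 : ∀ F : BipyramidFace s, IsCellCoord F 0 1 := fun F =>
    isCellCoord_apex _ le_rfl zero_le_one
  have hz : ∀ F : BipyramidFace s, IsCellCoord F (1 / 4) (3 / 4) := isCellCoord_new
  rintro ((i | σ) | F) ((j | τ) | G) h <;> simp only [vertexPoint] at h
  · rw [cellPoint_eq_iff (h0 _) (h0 _)] at h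
    obtain ⟨-, ⟨h, -⟩ | ⟨-, ⟨h, -⟩ | ⟨h, -⟩ | ⟨-, h, -⟩⟩⟩ := h
    · norm_num at h
    · simp only at h
      rw [h]
    · norm_num at h
    · norm_num at h
  · rw [cellPoint_eq_iff (h0 _) (h1 _)] at h
    norm_num [Glued] at h
  · rw [cellPoint_eq_iff (h0 _) (hz _)] at h
    norm_num [Glued] at h
  · rw [cellPoint_eq_iff (h1 _) (h0 _)] at h
    norm_num [Glued] at h
  · rw [cellPoint_eq_iff (h1 _) (h1 _)] at h
    obtain ⟨-, ⟨-, h⟩ | ⟨h | h, -⟩⟩ := h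
    · simp only at h
      rw [h]
    · norm_num at h
    · simp only at h
      rw [h]
  · rw [cellPoint_eq_iff (h1 _) (hz _)] at h
    norm_num [Glued] at h
  · rw [cellPoint_eq_iff (hz _) (h0 _)] at h
    norm_num [Glued] at h
  · rw [cellPoint_eq_iff (hz _) (h1 _)] at h
    norm_num [Glued] at h
  · rw [cellPoint_eq_iff (hz _) (hz _)] at h
    rw [(h.eq_of_inner (by norm_num) (by norm_num) (by norm_num) (by norm_num)).1]

namespace Shape

lemma vertex_on_curve {F : BipyramidFace s} {k : Shape} {t : unitInterval}
    {v : BipyramidVertex s ⊕ BipyramidFace s} (h : curve F k t = vertexPoint hs v) :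
    t = 0 ∨ t = 1 := by
  by_contra! hcon
  have ht₀ : (0 : ℝ) < t := unitInterval.pos_iff_ne_zero.2 hcon.1
  have ht₁ : (t : ℝ) < 1 := unitInterval.lt_one_iff_ne_one.2 hcon.2
  have hc := k.isCellCoord_coord F t.2.1 t.2.2
  have hcases : (k = base ∨ k = side) ∨ k ≠ side ∧ k ≠ base := by tauto
  rw [curve_apply] at h
  obtain (i | σ) | G := v <;> simp only [vertexPoint] at h
  · rw [cellPoint_eq_iff hc (isCellCoord_base _ le_rfl zero_le_one)] at h
    rcases hcases with (rfl | rfl) | ⟨h₁, h₂⟩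
    · exact ht₀.ne' (h.eq_of_base ht₀ ht₁).2.1
    · exact ht₀.ne' h.1
    · exact (coord_mem_Ioo h₁ h₂ ht₀ ht₁).2.2.1.ne' h.1
  · rw [cellPoint_eq_iff hc (isCellCoord_apex _ le_rfl zero_le_one)] at h
    rcases hcases with (rfl | rfl) | ⟨h₁, h₂⟩
    · exact zero_ne_one h.1
    · exact ht₁.ne h.1
    · exact (coord_mem_Ioo h₁ h₂ ht₀ ht₁).2.2.2.ne h.1
  · rw [cellPoint_eq_iff hc (isCellCoord_new _)] at h
    obtain ⟨-, h₁, h₂⟩ := h.symm.eq_of_inner (by norm_num) (by norm_num) (by norm_num) (by norm_num)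
    cases k <;> simp only [coord] at h₁ h₂ <;> linarith

end Shape

/-- The indices of the edges of the bipyramid. A base-edge lies in two cells and is drawn in one
of them. -/
abbrev BipyramidEdge (s : ℕ) : Type :=
  {p : BipyramidFace s × Shape // p.2 = .side ∨ p.2 = .base ∧ p.1.2 = true}

/-- The indices of the edges of the bipyramid with inserted vertices. -/
abbrev BipyramidK4Edge (s : ℕ) : Type :=
  {p : BipyramidFace s × Shape // p.2 ≠ .side ∧ (p.2 = .base → p.1.2 = true)}

namespace Shape

/-- The vertex at which the curve of a given kind starts. -/
def src (F : BipyramidFace s) : Shape → BipyramidVertex s ⊕ BipyramidFace s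
  | base => .inl F.left
  | side => .inl F.left
  | toApex => .inr F
  | toLeft => .inl F.left
  | toRight => .inr F
  | paired => .inl F.left

/-- The vertex at which the curve of a given kind stops. -/
def tgt (F : BipyramidFace s) : Shape → BipyramidVertex s ⊕ BipyramidFace s
  | base => .inl F.right
  | side => .inl F.apex
  | toApex => .inl F.apex
  | toLeft => .inr F
  | toRight => .inl F.right
  | paired => .inl F.apex

lemma curve_zero (F : BipyramidFace s) (k : Shape) : curve F k 0 = vertexPoint hs (k.src F) := by
  rw [curve_apply]
  cases k <;> simp only [src, coord] <;> norm_num <;>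
    first | exact cellPoint_left hs F | simp [vertexPoint]

lemma curve_one (F : BipyramidFace s) (k : Shape) : curve F k 1 = vertexPoint hs (k.tgt F) := by
  rw [curve_apply]
  cases k <;> simp only [tgt, coord] <;> norm_num <;>
    first
    | exact cellPoint_right hs F
    | exact cellPoint_apex hs F (by norm_num) (by norm_num)
    | simp [vertexPoint]

end Shape

/-- The straight drawing of the bipyramid: the apex-edges are sides of the cells. -/
noncomputable def bipyramidSystem : CurveSystem (bipyramid s) (BipyramidEdge s) where
  pos v := vertexPoint hs (.inl v)
  src p := p.1.1.left
  tgt p := match p.1.2 with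
    | .base => p.1.1.right
    | _ => p.1.1.apex
  curve p := Shape.curve p.1.1 p.1.2
  Cross _ _ := False
  pos_injective := (vertexPoint_injective hs).comp Sum.inl_injective
  exists_index := by
    rintro ⟨⟨u, v⟩, h⟩
    rw [← Sym2.mk, SimpleGraph.mem_edgeSet] at h
    obtain i | σ := u <;> obtain j | τ := v
    · rcases (cycleGraph_adj_iff_finRotate (by omega)).1 h with rfl | rfl
      · exact ⟨⟨((i, true), .base), .inr ⟨rfl, rfl⟩⟩, rfl⟩
      · exact ⟨⟨((j, true), .base), .inr ⟨rfl, rfl⟩⟩, Sym2.eq_swap⟩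
    · exact ⟨⟨((i, τ), .side), .inl rfl⟩, rfl⟩
    · exact ⟨⟨((j, σ), .side), .inl rfl⟩, Sym2.eq_swap⟩
    · exact h.elim
  curve_zero := by
    rintro ⟨⟨F, k⟩, h⟩
    obtain rfl | ⟨rfl, -⟩ : k = .side ∨ k = .base ∧ _ := h
    · exact Shape.curve_zero hs F _
    · exact Shape.curve_zero hs F _
  curve_one := by
    rintro ⟨⟨F, k⟩, h⟩
    obtain rfl | ⟨rfl, -⟩ : k = .side ∨ k = .base ∧ _ := h
    · exact Shape.curve_one hs F _
    · exact Shape.curve_one hs F _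
  curve_injective p := Shape.curve_injective (by omega) _ _
  vertex_on_curve p t v h := Shape.vertex_on_curve hs h
  cross_of_meet := by
    intro p q t u hpq ht₀ ht₁ hu₀ hu₁ h
    exact hpq (Subtype.ext (Shape.eq_of_meet (unitInterval.pos_iff_ne_zero.2 ht₀)
      (unitInterval.lt_one_iff_ne_one.2 ht₁) (unitInterval.pos_iff_ne_zero.2 hu₀)
      (unitInterval.lt_one_iff_ne_one.2 hu₁) p.2 q.2 (Shape.curve_eq_curve_iff.1 h)))
  cross_unique _ _ _ h := h.elim
  cross_disjoint _ _ h := h.elim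
  cross_subsingleton _ _ h := h.elim
  cross_proper _ _ h := h.elim

/-- The drawing of the bipyramid with a crossed `K_4` in each face. -/
noncomputable def bipyramidK4System : CurveSystem (bipyramidK4 s) (BipyramidK4Edge s) where
  pos := vertexPoint hs
  src p := p.1.2.src p.1.1
  tgt p := p.1.2.tgt p.1.1
  curve p := Shape.curve p.1.1 p.1.2
  Cross p q := p.1.1 = q.1.1 ∧
    (p.1.2 = .paired ∧ q.1.2 = .toRight ∨ p.1.2 = .toRight ∧ q.1.2 = .paired)
  pos_injective := vertexPoint_injective hs
  exists_index := by
    have hnew : ∀ (F : BipyramidFace s) (u : BipyramidVertex s), u ∈ F.verts →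
        ∃ p : BipyramidK4Edge s, s(p.1.2.src p.1.1, p.1.2.tgt p.1.1) = s(.inl u, .inr F) := by
      rintro F u (rfl | rfl | rfl)
      · exact ⟨⟨(F, .toApex), by simp⟩, Sym2.eq_swap⟩
      · exact ⟨⟨(F, .toLeft), by simp⟩, rfl⟩
      · exact ⟨⟨(F, .toRight), by simp⟩, Sym2.eq_swap⟩
    rintro ⟨⟨u, v⟩, h⟩
    rw [← Sym2.mk, SimpleGraph.mem_edgeSet] at h
    obtain u | F := u <;> obtain v | G := v
    · obtain i | σ := u <;> obtain j | τ := v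
      · rcases (cycleGraph_adj_iff_finRotate (by omega)).1 h with rfl | rfl
        · exact ⟨⟨((i, true), .base), by simp⟩, rfl⟩
        · exact ⟨⟨((j, true), .base), by simp⟩, Sym2.eq_swap⟩
      · exact ⟨⟨((i, τ), .paired), by simp⟩, rfl⟩
      · exact ⟨⟨((j, σ), .paired), by simp⟩, Sym2.eq_swap⟩
      · exact h.elim
    · exact hnew G u h
    · obtain ⟨p, hp⟩ := hnew F v h
      exact ⟨p, hp.trans Sym2.eq_swap⟩
    · exact h.elim
  curve_zero p := Shape.curve_zero hs _ _
  curve_one p := Shape.curve_one hs _ _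
  curve_injective p := Shape.curve_injective (by omega) _ _
  vertex_on_curve p t v h := Shape.vertex_on_curve hs h
  cross_of_meet := by
    intro p q t u hpq ht₀ ht₁ hu₀ hu₁ h
    exact Shape.crossing_pair_of_meet (unitInterval.pos_iff_ne_zero.2 ht₀)
      (unitInterval.lt_one_iff_ne_one.2 ht₁) (unitInterval.pos_iff_ne_zero.2 hu₀)
      (unitInterval.lt_one_iff_ne_one.2 hu₁) p.2.1 q.2.1 p.2.2 q.2.2
      (fun h => hpq (Subtype.ext h)) (Shape.curve_eq_curve_iff.1 h)
  cross_unique := by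
    rintro ⟨⟨F, k⟩, _⟩ ⟨⟨G, l⟩, _⟩ ⟨⟨H, m⟩, _⟩ ⟨rfl, h⟩ ⟨rfl, h'⟩
    simp only at h h'
    rcases h with ⟨rfl, rfl⟩ | ⟨rfl, rfl⟩ <;> simp at h' <;> subst h' <;> rfl
  cross_disjoint := by
    rintro ⟨⟨F, k⟩, _⟩ ⟨⟨G, l⟩, _⟩ ⟨rfl, h⟩ v hv hv'
    have hne := ne_finRotate (show 2 ≤ s - 2 by omega) F.1
    simp only at h
    rcases h with ⟨rfl, rfl⟩ | ⟨rfl, rfl⟩ <;> simp only [Shape.src, Shape.tgt, Sym2.mem_iff] at hv hv'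
      <;> rcases hv with rfl | rfl <;> rcases hv' with h | h <;>
      first
      | cases h
      | exact hne (Sum.inl_injective (Sum.inl_injective h))
      | exact hne.symm (Sum.inl_injective (Sum.inl_injective h))
  cross_subsingleton := by
    rintro ⟨⟨F, k⟩, _⟩ ⟨⟨G, l⟩, _⟩ ⟨rfl, h⟩ p ⟨hp, hp'⟩ q ⟨hq, hq'⟩
    simp only at h
    have hn : 2 ≤ s - 2 := by omega
    rcases h with ⟨rfl, rfl⟩ | ⟨rfl, rfl⟩
    · rw [Shape.eq_crossing hn hp hp', Shape.eq_crossing hn hq hq']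
    · rw [Shape.eq_crossing hn hp' hp, Shape.eq_crossing hn hq' hq]
  cross_proper := by
    rintro ⟨⟨F, k⟩, _⟩ ⟨⟨G, l⟩, _⟩ ⟨rfl, h⟩ p hp hp'
    simp only at h
    have hn : 2 ≤ s - 2 := by omega
    rcases h with ⟨rfl, rfl⟩ | ⟨rfl, rfl⟩
    · exact Shape.properlyCrossAt hn hp hp'
    · exact (Shape.properlyCrossAt hn hp' hp).symm

end Drawings

/-! ### The crossed insertion -/

lemma isPreconnected_puncturedBox {a b : ℝ} (ha : a ∈ Set.Ioo (0 : ℝ) 1)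
    (hb : b ∈ Set.Ioo (0 : ℝ) 1) :
    IsPreconnected ((Set.Ioo (0 : ℝ) 1 ×ˢ Set.Ioo (0 : ℝ) 1) \ {(a, b)}) := by
  obtain ⟨ha₀, ha₁⟩ := ha
  obtain ⟨hb₀, hb₁⟩ := hb
  have hpre : ∀ u v w z : ℝ, IsPreconnected (Set.Ioo u v ×ˢ Set.Ioo w z) := fun u v w z =>
    isPreconnected_Ioo.prod isPreconnected_Ioo
  -- the four open boxes left, above, right and below the removed point
  have h : IsPreconnected (((Set.Ioo 0 a ×ˢ Set.Ioo (0 : ℝ) 1 ∪ Set.Ioo (0 : ℝ) 1 ×ˢ Set.Ioo b 1) ∪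
      Set.Ioo a 1 ×ˢ Set.Ioo (0 : ℝ) 1) ∪ Set.Ioo (0 : ℝ) 1 ×ˢ Set.Ioo 0 b) := by
    refine IsPreconnected.union' ?_ (IsPreconnected.union' ?_ (IsPreconnected.union' ?_
      (hpre _ _ _ _) (hpre _ _ _ _)) (hpre _ _ _ _)) (hpre _ _ _ _)
    · exact ⟨(a / 2, b / 2), .inl (.inl ⟨⟨by simp only; linarith, by simp only; linarith⟩,
        by simp only; linarith, by simp only; linarith⟩),
        ⟨by simp only; linarith, by simp only; linarith⟩,
        by simp only; linarith, by simp only; linarith⟩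
    · exact ⟨((a + 1) / 2, (b + 1) / 2), .inr ⟨⟨by simp only; linarith, by simp only; linarith⟩,
        by simp only; linarith, by simp only; linarith⟩,
        ⟨by simp only; linarith, by simp only; linarith⟩,
        by simp only; linarith, by simp only; linarith⟩
    · exact ⟨(a / 2, (b + 1) / 2), ⟨⟨by simp only; linarith, by simp only; linarith⟩,
        by simp only; linarith, by simp only; linarith⟩,
        ⟨by simp only; linarith, by simp only; linarith⟩,
        by simp only; linarith, by simp only; linarith⟩
  convert h using 1
  ext ⟨x, y⟩
  simp only [Set.mem_sdiff, Set.mem_prod, Set.mem_Ioo, Set.mem_singleton_iff, Prod.mk.injEq,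
    Set.mem_union]
  constructor
  · rintro ⟨⟨⟨h₁, h₂⟩, h₃, h₄⟩, h₅⟩
    rcases lt_trichotomy x a with h | h | h
    · exact .inl (.inl (.inl ⟨⟨h₁, h⟩, h₃, h₄⟩))
    · rcases lt_trichotomy y b with h' | h' | h'
      · exact .inr ⟨⟨h₁, h₂⟩, h₃, h'⟩
      · exact absurd ⟨h, h'⟩ h₅
      · exact .inl (.inl (.inr ⟨⟨h₁, h₂⟩, h', h₄⟩))
    · exact .inl (.inr ⟨⟨h, h₂⟩, h₃, h₄⟩)
  · rintro (((⟨⟨h₁, h₂⟩, h₃, h₄⟩ | ⟨⟨h₁, h₂⟩, h₃, h₄⟩) | ⟨⟨h₁, h₂⟩, h₃, h₄⟩) |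
      ⟨⟨h₁, h₂⟩, h₃, h₄⟩)
    · exact ⟨⟨⟨h₁, by linarith⟩, h₃, h₄⟩, fun h => by linarith [h.1]⟩
    · exact ⟨⟨⟨h₁, h₂⟩, by linarith, h₄⟩, fun h => by linarith [h.2]⟩
    · exact ⟨⟨⟨by linarith, h₂⟩, h₃, h₄⟩, fun h => by linarith [h.1]⟩
    · exact ⟨⟨⟨h₁, h₂⟩, h₃, by linarith⟩, fun h => by linarith [h.2]⟩

/-- The open cell as a part of the plane. -/
def openCell {n : ℕ} (F : Fin n × Bool) : Set Plane :=
  cellImage F (Set.Ioo (0 : ℝ) 1 ×ˢ Set.Ioo (0 : ℝ) 1)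

lemma isOpen_openCell {n : ℕ} (F : Fin n × Bool) : IsOpen (openCell F) :=
  isOpen_cellImage F (isOpen_Ioo.prod isOpen_Ioo) le_rfl

lemma isPreconnected_openCell {n : ℕ} (F : Fin n × Bool) : IsPreconnected (openCell F) := by
  have himage : openCell F = (fun p : ℝ × ℝ => cellPoint F p.1 p.2) ''
      {p | p ∈ Set.Ioo (0 : ℝ) 1 ×ˢ Set.Ioo (0 : ℝ) 1 ∧ IsCellCoord F p.1 p.2} := by
    ext w
    constructor
    · rintro ⟨x, h, h₁, h₂, rfl⟩
      exact ⟨(x, h), ⟨h₁, h₂⟩, rfl⟩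
    · rintro ⟨⟨x, h⟩, ⟨h₁, h₂⟩, rfl⟩
      exact ⟨x, h, h₁, h₂, rfl⟩
  rw [himage]
  refine IsPreconnected.image ?_ _
    fun p hp => (continuousAt_cellPoint hp.2).continuousWithinAt
  by_cases hF : F.1.val = 0 ∧ F.2 = true
  · convert isPreconnected_puncturedBox (a := 1 / 8) (b := 3 / 4) (by norm_num) (by norm_num) using 1
    ext ⟨x, h⟩
    simp only [Set.mem_prod, Set.mem_Ioo, Set.mem_ofPred_eq, Set.mem_sdiff, Set.mem_singleton_iff,
      Prod.mk.injEq]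
    refine and_congr_right fun hp => ⟨fun hc he => hc.2.2.2.2 ⟨hF.1, hF.2, he⟩, fun hc => ?_⟩
    exact ⟨hp.1.1.le, hp.1.2.le, hp.2.1.le, hp.2.2.le, fun he => hc he.2.2⟩
  · convert (isPreconnected_Ioo (a := (0 : ℝ)) (b := 1)).prod
      (isPreconnected_Ioo (a := (0 : ℝ)) (b := 1)) using 1
    ext ⟨x, h⟩
    simp only [Set.mem_prod, Set.mem_Ioo, Set.mem_ofPred_eq]
    refine and_iff_left_of_imp fun hp => ?_
    exact ⟨hp.1.1.le, hp.1.2.le, hp.2.1.le, hp.2.2.le, fun he => hF ⟨he.1, he.2.1⟩⟩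

/-- The coordinates lie on the boundary of the unit square. -/
def IsBoundaryCoord (x h : ℝ) : Prop := x = 0 ∨ x = 1 ∨ h = 0 ∨ h = 1

lemma boundary_notMem_openCell {n : ℕ} {F G : Fin n × Bool} {x h : ℝ} (hc : IsCellCoord G x h)
    (hb : IsBoundaryCoord x h) : cellPoint G x h ∉ openCell F := by
  rintro ⟨y, k, ⟨⟨h₁, h₂⟩, h₃, h₄⟩, hc', he⟩
  simp only at h₁ h₂ h₃ h₄
  obtain ⟨-, rfl, rfl⟩ := ((cellPoint_eq_iff hc' hc).1 he).eq_of_inner h₁ h₂ h₃ h₄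
  rcases hb with hb | hb | hb | hb <;> linarith

lemma boundary_mem_closure_openCell {n : ℕ} {F : Fin n × Bool} {x h : ℝ} (hc : IsCellCoord F x h)
    (hb : IsBoundaryCoord x h) : cellPoint F x h ∈ closure (openCell F) := by
  -- approach the point on the segment from the centre of the cell
  set γ : ℝ → ℝ × ℝ := fun t => (x + t * (1 / 2 - x), h + t * (1 / 2 - h)) with hγ
  have hγc : Continuous γ := by fun_prop
  have hγ0 : γ 0 = (x, h) := by simp [hγ]
  have ht : Filter.Tendsto (fun t => cellPoint F (γ t).1 (γ t).2)
      (nhdsWithin 0 (Set.Ioi 0)) (nhds (cellPoint F x h)) := by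
    have h₁ : ContinuousAt (fun p : ℝ × ℝ => cellPoint F p.1 p.2) (γ 0) := by
      rw [hγ0]; exact continuousAt_cellPoint hc
    have h₂ := ContinuousAt.comp h₁ hγc.continuousAt
    have h₃ := h₂.tendsto
    simp only [Function.comp_def, hγ0] at h₃
    exact h₃.mono_left nhdsWithin_le_nhds
  have hne : ∀ᶠ t in nhdsWithin (0 : ℝ) (Set.Ioi 0), γ t ≠ (1 / 8, 3 / 4) := by
    refine Filter.Eventually.filter_mono nhdsWithin_le_nhds (hγc.continuousAt.eventually_ne ?_)
    rw [hγ0, Ne, Prod.mk.injEq]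
    rintro ⟨rfl, rfl⟩
    norm_num [IsBoundaryCoord] at hb
  refine mem_closure_of_tendsto ht ?_
  filter_upwards [hne, Ioo_mem_nhdsGT (zero_lt_one' ℝ)] with t htne ht
  obtain ⟨ht₀, ht₁⟩ := ht
  obtain ⟨hx₀, hx₁, hh₀, hh₁, -⟩ := hc
  have h₁ : 0 < (γ t).1 := by simp only [hγ]; nlinarith
  have h₂ : (γ t).1 < 1 := by simp only [hγ]; nlinarith
  have h₃ : 0 < (γ t).2 := by simp only [hγ]; nlinarith
  have h₄ : (γ t).2 < 1 := by simp only [hγ]; nlinarith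
  exact ⟨(γ t).1, (γ t).2, ⟨⟨h₁, h₂⟩, h₃, h₄⟩,
    ⟨h₁.le, h₂.le, h₃.le, h₄.le, fun he => htne (Prod.ext he.2.2.1 he.2.2.2)⟩, rfl⟩

lemma mem_frontier_openCell {n : ℕ} {F : Fin n × Bool} {w : Plane} : w ∈ frontier (openCell F) ↔
    ∃ x h, IsCellCoord F x h ∧ IsBoundaryCoord x h ∧ cellPoint F x h = w := by
  rw [(isOpen_openCell F).frontier_eq]
  constructor
  · rintro ⟨hw, hw'⟩
    have hsub : openCell F ⊆ cellImage F Set.univ := by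
      rintro _ ⟨x, h, -, hc, rfl⟩
      exact ⟨x, h, trivial, hc, rfl⟩
    obtain ⟨x, h, -, hc, rfl⟩ :=
      closure_minimal hsub (isClosed_cellImage F isClosed_univ) hw
    refine ⟨x, h, hc, ?_, rfl⟩
    by_contra hb
    simp only [IsBoundaryCoord, not_or] at hb
    exact hw' ⟨x, h, ⟨⟨lt_of_le_of_ne hc.1 (Ne.symm hb.1), lt_of_le_of_ne hc.2.1 hb.2.1⟩,
      lt_of_le_of_ne hc.2.2.1 (Ne.symm hb.2.2.1), lt_of_le_of_ne hc.2.2.2.1 hb.2.2.2⟩, hc, rfl⟩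
  · rintro ⟨x, h, hc, hb, rfl⟩
    exact ⟨boundary_mem_closure_openCell hc hb, boundary_notMem_openCell hc hb⟩

/-- A connected open set whose frontier is covered by the drawing is a face as soon as it is
disjoint from the drawing. -/
lemma Drawing.isFace_of_frontier_subset {V : Type*} {G : SimpleGraph V} {D : Drawing G}
    {R : Set Plane} (hR : IsOpen R) (hc : IsPreconnected R) (hne : R.Nonempty)
    (hd : R ⊆ D.supportᶜ) (hf : frontier R ⊆ D.support) : D.IsFace R := by
  obtain ⟨x, hx⟩ := hne
  refine ⟨x, hd hx, (hc.subset_connectedComponentIn hx hd).antisymm ?_⟩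
  refine isPreconnected_connectedComponentIn.subset_of_closure_inter_subset hR
    ⟨x, mem_connectedComponentIn (hd hx), hx⟩ ?_
  rintro y ⟨hy, hy'⟩
  by_contra hyR
  refine connectedComponentIn_subset _ _ hy' (hf ?_)
  rw [hR.frontier_eq]
  exact ⟨hy, hyR⟩

lemma finRotate_finRotate_ne {n : ℕ} (hn : 3 ≤ n) (i : Fin n) :
    finRotate n (finRotate n i) ≠ i := by
  have hi := val_finRotate i
  have hi' := val_finRotate (finRotate n i)
  rw [Ne, Fin.ext_iff]
  split_ifs at hi hi' <;> omega

section Insertion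

variable {s : ℕ} (hs : 8 ≤ s)

lemma base_injective {n : ℕ} (hn : 3 ≤ n) {a b : Fin n}
    (h : s(a, finRotate n a) = s(b, finRotate n b)) : a = b := by
  rcases Sym2.eq_iff.1 h with ⟨h, -⟩ | ⟨h, h'⟩
  · exact h
  · rw [h] at h'
    exact absurd h' (finRotate_finRotate_ne hn b)

lemma BipyramidEdge.eq_base {p : BipyramidEdge s} {i j : Fin (s - 2)}
    (h : s((bipyramidSystem hs).src p, (bipyramidSystem hs).tgt p) = s(.inl i, .inl j)) :
    ∃ a, p.1 = ((a, true), .base) ∧ s(a, finRotate _ a) = s(i, j) := by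
  obtain ⟨⟨⟨a, σ⟩, k⟩, hp⟩ := p
  obtain rfl | ⟨rfl, rfl⟩ : k = .side ∨ k = .base ∧ σ = true := hp
  · rcases Sym2.eq_iff.1 h with ⟨-, h⟩ | ⟨-, h⟩ <;> cases h
  · exact ⟨a, rfl, Sym2.map.injective Sum.inl_injective h⟩

lemma BipyramidEdge.ends_injective {p q : BipyramidEdge s}
    (h : s((bipyramidSystem hs).src p, (bipyramidSystem hs).tgt p) =
      s((bipyramidSystem hs).src q, (bipyramidSystem hs).tgt q)) : p = q := by
  obtain ⟨⟨⟨a, σ⟩, k⟩, hp⟩ := p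
  obtain ⟨⟨⟨b, τ⟩, l⟩, hq⟩ := q
  obtain rfl | ⟨rfl, rfl⟩ : k = .side ∨ k = .base ∧ σ = true := hp
  · obtain rfl | ⟨rfl, rfl⟩ : l = .side ∨ l = .base ∧ τ = true := hq
    · rcases Sym2.eq_iff.1 h with ⟨h₁, h₂⟩ | ⟨h₁, -⟩
      · cases h₁; cases h₂; rfl
      · cases h₁
    · rcases Sym2.eq_iff.1 h with ⟨-, h⟩ | ⟨-, h⟩ <;> cases h
  · obtain rfl | ⟨rfl, rfl⟩ : l = .side ∨ l = .base ∧ τ = true := hq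
    · rcases Sym2.eq_iff.1 h with ⟨-, h⟩ | ⟨h, -⟩ <;> cases h
    · obtain rfl := base_injective (by omega) (Sym2.map.injective Sum.inl_injective h)
      rfl

lemma BipyramidK4Edge.eq_base {p : BipyramidK4Edge s} {i j : Fin (s - 2)}
    (h : s((bipyramidK4System hs).src p, (bipyramidK4System hs).tgt p) =
      s(.inl (.inl i), .inl (.inl j))) :
    ∃ a, p.1 = ((a, true), .base) ∧ s(a, finRotate _ a) = s(i, j) := by
  obtain ⟨⟨⟨a, σ⟩, k⟩, hp⟩ := p
  cases k
  case base =>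
    obtain rfl : σ = true := hp.2 rfl
    exact ⟨a, rfl, Sym2.map.injective (Sum.inl_injective.comp Sum.inl_injective) h⟩
  case side => exact absurd rfl hp.1
  all_goals rcases Sym2.eq_iff.1 h with ⟨h, h'⟩ | ⟨h, h'⟩ <;> first | (cases h; done) | cases h'

lemma BipyramidK4Edge.eq_paired {p : BipyramidK4Edge s} {F : BipyramidFace s}
    (h : s((bipyramidK4System hs).src p, (bipyramidK4System hs).tgt p) =
      s(.inl F.apex, .inl F.left)) : p.1 = (F, .paired) := by
  obtain ⟨⟨⟨a, σ⟩, k⟩, hp⟩ := p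
  obtain ⟨b, τ⟩ := F
  cases k
  case side => exact absurd rfl hp.1
  case paired =>
    rcases Sym2.eq_iff.1 h with ⟨h, h'⟩ | ⟨h, h'⟩
    · cases h
    · cases h; cases h'; rfl
  all_goals rcases Sym2.eq_iff.1 h with ⟨h, h'⟩ | ⟨h, h'⟩ <;> first | (cases h; done) | cases h'

lemma BipyramidK4Edge.eq_of_mem {p : BipyramidK4Edge s} {F : BipyramidFace s}
    (h : .inr F ∈ s((bipyramidK4System hs).src p, (bipyramidK4System hs).tgt p)) :
    p.1 = (F, .toApex) ∨ p.1 = (F, .toLeft) ∨ p.1 = (F, .toRight) := by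
  obtain ⟨⟨G, k⟩, hp⟩ := p
  rw [Sym2.mem_iff] at h
  cases k
  case side => exact absurd rfl hp.1
  all_goals rcases h with h | h <;> cases h <;> simp

lemma BipyramidK4Edge.eq_toRight {p : BipyramidK4Edge s} {F : BipyramidFace s}
    (h : s((bipyramidK4System hs).src p, (bipyramidK4System hs).tgt p) =
      s(.inr F, .inl F.right)) : p.1 = (F, .toRight) := by
  have hmem := BipyramidK4Edge.eq_of_mem hs (p := p) (F := F) (by rw [h]; exact Sym2.mem_mk_left _ _)
  obtain ⟨⟨G, k⟩, hp⟩ := p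
  simp only [Prod.mk.injEq] at hmem ⊢
  rcases hmem with ⟨rfl, rfl⟩ | ⟨rfl, rfl⟩ | ⟨rfl, rfl⟩
  · rcases Sym2.eq_iff.1 h with ⟨-, h⟩ | ⟨h, -⟩ <;> cases h
  · rcases Sym2.eq_iff.1 h with ⟨h, -⟩ | ⟨h, -⟩
    · cases h
    · exact absurd (Sum.inl_injective (Sum.inl_injective h)) (ne_finRotate (by omega) _)
  · exact ⟨rfl, rfl⟩

/-- The drawing of the bipyramid covers only boundary points of cells. -/
lemma exists_boundaryCoord_of_mem_support {w : Plane}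
    (hw : w ∈ (bipyramidSystem hs).toDrawing.support) :
    ∃ (G : BipyramidFace s) (x h : ℝ), IsCellCoord G x h ∧ IsBoundaryCoord x h ∧
      cellPoint G x h = w := by
  rcases hw with ⟨i | σ, rfl⟩ | hw
  · exact ⟨_, _, _, isCellCoord_base _ le_rfl zero_le_one, .inl rfl, rfl⟩
  · exact ⟨_, _, _, isCellCoord_apex _ le_rfl zero_le_one, .inl rfl, rfl⟩
  · obtain ⟨e, t, rfl⟩ := Set.mem_iUnion.1 hw
    change ∃ G x h, _ ∧ _ ∧ _ = Shape.curve _ _ t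
    obtain ⟨⟨G, k⟩, hp⟩ := (bipyramidSystem hs).index e
    refine ⟨G, _, _, Shape.isCellCoord_coord G k t.2.1 t.2.2, ?_, rfl⟩
    obtain rfl | ⟨rfl, -⟩ : k = .side ∨ k = .base ∧ G.2 = true := hp
    · exact .inl rfl
    · exact .inr (.inr (.inl rfl))

lemma cellPoint_side_right (F : BipyramidFace s) {h : ℝ} (h₀ : 0 ≤ h) (h₁ : h ≤ 1) :
    cellPoint F 1 h = cellPoint (finRotate (s - 2) F.1, F.2) 0 h :=
  (cellPoint_eq_iff (isCellCoord_right_side _ h₀ h₁) (isCellCoord_side _ h₀ h₁)).2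
    ⟨rfl, .inr ⟨.inr rfl, .inr (.inl ⟨rfl, rfl, rfl⟩)⟩⟩

lemma cellPoint_base (F : BipyramidFace s) (σ : Bool) {x : ℝ} (h₀ : 0 ≤ x) (h₁ : x ≤ 1) :
    cellPoint (F.1, σ) x 0 = cellPoint F x 0 :=
  (cellPoint_eq_iff (isCellCoord_base _ h₀ h₁) (isCellCoord_base _ h₀ h₁)).2
    ⟨rfl, .inr ⟨.inl rfl, .inl ⟨rfl, rfl⟩⟩⟩

lemma frontier_openCell (F : BipyramidFace s) : frontier (openCell F) =
    ⋃ (e : (bipyramid s).edgeSet) (_ : ∀ v ∈ e.1, v ∈ F.verts),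
      Set.range ((bipyramidSystem hs).toDrawing.curve e) := by
  ext w
  rw [mem_frontier_openCell]
  simp only [Set.mem_iUnion, exists_prop]
  constructor
  · rintro ⟨x, h, hc, hb, rfl⟩
    obtain ⟨hx₀, hx₁, hh₀, hh₁, -⟩ := hc
    -- it suffices to name an index whose curve covers the point
    have key : ∀ p : BipyramidEdge s, (bipyramidSystem hs).src p ∈ F.verts →
        (bipyramidSystem hs).tgt p ∈ F.verts →
        (bipyramid s).Adj ((bipyramidSystem hs).src p) ((bipyramidSystem hs).tgt p) →
        cellPoint F x h ∈ Set.range (Shape.curve p.1.1 p.1.2) →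
        ∃ e : (bipyramid s).edgeSet, (∀ v ∈ e.1, v ∈ F.verts) ∧
          cellPoint F x h ∈ Set.range ((bipyramidSystem hs).toDrawing.curve e) := by
      intro p hsrc htgt hadj hmem
      refine ⟨⟨s(_, _), hadj⟩, ?_, ?_⟩
      · intro v hv
        rcases Sym2.mem_iff.1 hv with rfl | rfl
        · exact hsrc
        · exact htgt
      · have hidx : (bipyramidSystem hs).index ⟨s(_, _), hadj⟩ = p :=
          BipyramidEdge.ends_injective hs ((bipyramidSystem hs).ends_index _)
        change _ ∈ Set.range ((bipyramidSystem hs).curve _)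
        rw [hidx]
        exact hmem
    rcases hb with rfl | rfl | rfl | rfl
    · exact key ⟨(F, .side), .inl rfl⟩ (by simp [bipyramidSystem, BipyramidFace.verts])
        (by simp [bipyramidSystem, BipyramidFace.verts]) trivial ⟨⟨h, hh₀, hh₁⟩, rfl⟩
    · refine key ⟨((finRotate _ F.1, F.2), .side), .inl rfl⟩ (.inr (.inr rfl)) (.inl rfl) trivial
        ⟨⟨h, hh₀, hh₁⟩, ?_⟩
      rw [cellPoint_side_right F hh₀ hh₁]
      rfl
    · refine key ⟨((F.1, true), .base), .inr ⟨rfl, rfl⟩⟩ (.inr (.inl rfl)) (.inr (.inr rfl))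
        ((cycleGraph_adj_iff_finRotate (by omega)).2 (.inl rfl)) ⟨⟨x, hx₀, hx₁⟩, ?_⟩
      exact cellPoint_base F true hx₀ hx₁
    · refine key ⟨(F, .side), .inl rfl⟩ (by simp [bipyramidSystem, BipyramidFace.verts])
        (by simp [bipyramidSystem, BipyramidFace.verts]) trivial ⟨1, ?_⟩
      rw [Shape.curve_one hs, cellPoint_apex hs F hx₀ hx₁]
      rfl
  · rintro ⟨e, he, t, rfl⟩
    rw [← (bipyramidSystem hs).ends_index e] at he
    have h₁ := he _ (Sym2.mem_mk_left _ _)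
    have h₂ := he _ (Sym2.mem_mk_right _ _)
    change ∃ x h, _ ∧ _ ∧ _ = Shape.curve _ _ t
    clear he
    revert h₁ h₂
    generalize (bipyramidSystem hs).index e = p
    obtain ⟨⟨⟨a, σ⟩, k⟩, hp⟩ := p
    intro h₁ h₂
    obtain rfl | ⟨rfl, rfl⟩ : k = .side ∨ k = .base ∧ σ = true := hp
    · obtain rfl : σ = F.2 := by
        obtain h | h | h : _ ∨ _ ∨ _ := h₂
        · cases h; rfl
        · cases h
        · cases h
      obtain h | h | h : _ ∨ _ ∨ _ := h₁
      · cases h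
      · obtain rfl : a = F.1 := Sum.inl_injective h
        exact ⟨_, _, isCellCoord_side F t.2.1 t.2.2, .inl rfl, rfl⟩
      · obtain rfl : a = finRotate _ F.1 := Sum.inl_injective h
        exact ⟨_, _, isCellCoord_right_side F t.2.1 t.2.2, .inr (.inl rfl),
          cellPoint_side_right F t.2.1 t.2.2⟩
    · have haF : a = F.1 := by
        obtain h | h | h : _ ∨ _ ∨ _ := h₁
        · cases h
        · exact Sum.inl_injective h
        · obtain rfl : a = finRotate _ F.1 := Sum.inl_injective h
          obtain h | h | h : _ ∨ _ ∨ _ := h₂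
          · cases h
          · exact absurd (Sum.inl_injective h) (finRotate_finRotate_ne (by omega) _)
          · exact absurd (Sum.inl_injective h).symm (ne_finRotate (by omega) _)
      subst haF
      exact ⟨_, _, isCellCoord_base F t.2.1 t.2.2, .inr (.inr (.inl rfl)),
        (cellPoint_base F true t.2.1 t.2.2).symm⟩

lemma isFace_openCell (F : BipyramidFace s) :
    (bipyramidSystem hs).toDrawing.IsFace (openCell F) := by
  refine Drawing.isFace_of_frontier_subset (isOpen_openCell F) (isPreconnected_openCell F)
    ⟨_, _, _, ⟨⟨by norm_num, by norm_num⟩, by norm_num, by norm_num⟩, isCellCoord_new F, rfl⟩ ?_ ?_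
  · intro w hw hw'
    obtain ⟨G, x, h, hc, hb, rfl⟩ := exists_boundaryCoord_of_mem_support hs hw'
    exact boundary_notMem_openCell hc hb hw
  · rw [frontier_openCell hs]
    intro w hw
    obtain ⟨e, -, hw⟩ := Set.mem_iUnion₂.1 hw
    exact .inr (Set.mem_iUnion.2 ⟨e, hw⟩)

lemma isCrossedK4Insertion : IsCrossedK4Insertion (bipyramidSystem hs).toDrawing
    (bipyramidK4System hs).toDrawing where
  planar := (bipyramidSystem hs).isKPlanar_zero fun _ _ h => h
  pos_eq _ := rfl
  base_eq i j e e' he he' := by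
    rw [← (bipyramidSystem hs).ends_index] at he
    rw [← (bipyramidK4System hs).ends_index] at he'
    obtain ⟨a, ha, ha'⟩ := BipyramidEdge.eq_base hs he
    obtain ⟨b, hb, hb'⟩ := BipyramidK4Edge.eq_base hs he'
    obtain rfl := base_injective (by omega) (ha'.trans hb'.symm)
    change Shape.curve _ _ = Shape.curve _ _
    rw [ha, hb]
  inside F := by
    refine ⟨openCell F, isFace_openCell hs F, frontier_openCell hs F,
      ⟨_, _, ⟨⟨by norm_num, by norm_num⟩, by norm_num, by norm_num⟩, isCellCoord_new F, rfl⟩,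
      fun e he t ht₀ ht₁ => ?_⟩
    rw [← (bipyramidK4System hs).ends_index] at he
    obtain ⟨k, hk, hk₁, hk₂⟩ : ∃ k, ((bipyramidK4System hs).index e).1 = (F, k) ∧
        k ≠ .side ∧ k ≠ .base := by
      rcases he with he | he
      · rcases BipyramidK4Edge.eq_of_mem hs he with h | h | h
        · exact ⟨_, h, by simp, by simp⟩
        · exact ⟨_, h, by simp, by simp⟩
        · exact ⟨_, h, by simp, by simp⟩
      · exact ⟨_, BipyramidK4Edge.eq_paired hs he, by simp, by simp⟩
    change Shape.curve _ _ t ∈ _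
    rw [hk]
    obtain ⟨h₁, h₂, h₃, h₄⟩ := Shape.coord_mem_Ioo hk₁ hk₂ (unitInterval.pos_iff_ne_zero.2 ht₀)
      (unitInterval.lt_one_iff_ne_one.2 ht₁)
    exact ⟨_, _, ⟨⟨h₁, h₂⟩, h₃, h₄⟩, Shape.isCellCoord_coord F k t.2.1 t.2.2, rfl⟩
  crossing F e f he hf := by
    rw [← (bipyramidK4System hs).ends_index] at he hf
    have he' := BipyramidK4Edge.eq_paired hs he
    have hf' := BipyramidK4Edge.eq_toRight hs hf
    refine ⟨cellPoint F (1 / 3) (2 / 3), (bipyramidK4System hs).crossAt_of_cross ?_ ?_ ?_⟩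
    · exact ⟨by rw [he', hf'], .inl ⟨by rw [he'], by rw [hf']⟩⟩
    · change _ ∈ Set.range (Shape.curve _ _)
      rw [he']
      exact Shape.crossing_mem_paired F
    · change _ ∈ Set.range (Shape.curve _ _)
      rw [hf']
      exact Shape.crossing_mem_toRight F

end Insertion

/-! ### Saturation -/

namespace Drawing

variable {V : Type*} {G G' : SimpleGraph V}

/-- In a 1-planar extension, a new edge does not cross an old edge that was crossed already. -/
lemma not_crossAt_of_extends {D : Drawing G} {D' : Drawing G'} (hD : D'.Extends D)
    (hpl : D'.IsKPlanar 1) {f g : G.edgeSet} {p₀ : Plane} (hfg : D.CrossAt f g p₀)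
    {e f' : G'.edgeSet} (he : e.1 ∉ G.edgeSet) (hf : f'.1 = f.1) {p : Plane} :
    ¬ D'.CrossAt f' e p := by
  intro hp
  obtain ⟨hle, hpos, hcurve⟩ := hD
  obtain ⟨hne, hpf, hpg, hnv⟩ := hfg
  have hg' : g.1 ∈ G'.edgeSet := SimpleGraph.edgeSet_mono hle g.2
  have hcf : D'.curve f' = D.curve f := hcurve f f' hf
  have hcg : D'.curve ⟨g.1, hg'⟩ = D.curve g := hcurve g ⟨g.1, hg'⟩ rfl
  have hne' : f' ≠ ⟨g.1, hg'⟩ := fun h => hne (Subtype.ext (hf.symm.trans (congrArg Subtype.val h)))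
  have hc : D'.CrossAt f' ⟨g.1, hg'⟩ p₀ :=
    ⟨hne', by rwa [hcf], by rwa [hcg], by rwa [hpos, hf]⟩
  have hsub := hpl f'
  rw [Nat.cast_one, Set.encard_le_one_iff_subsingleton] at hsub
  obtain rfl : p = p₀ := hsub ⟨_, hp⟩ ⟨_, hc⟩
  have hge : (⟨g.1, hg'⟩ : G'.edgeSet) ≠ e := fun h => he (h ▸ g.2)
  obtain ⟨v, hv, hv', -, hpv⟩ := D'.three f' ⟨g.1, hg'⟩ e hne' hge hp.1 p hc.2.1 hc.2.2.1 hp.2.2.1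
  exact hc.2.2.2 ⟨v, hv, hv', hpv⟩

end Drawing

section Regions

variable {s : ℕ} (hs : 8 ≤ s)

/-- The crossing edges `paired` and `toRight` cut a cell into three parts, which are glued along the
other edges and sides to the regions of the plane. The first part, at the apex and the left
base-vertex, belongs to the region of the new vertex of the cell, the second part, at the apex and
the right base-vertex, to that of the next cell, and the third part to the region of the
base-edge. The lines of the two edges are used in full, which is harmless: the extra piece of the
line of `toRight` lies in the first part. -/
def HasLabel (F : BipyramidFace s) (x h : ℝ) (L : BipyramidFace s ⊕ Fin (s - 2)) : Prop :=
  (2 * x ≤ h ∧ L = .inl F) ∨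
  ((h ≤ 2 * x ∧ 1 - x ≤ h) ∧ L = .inl (finRotate (s - 2) F.1, F.2)) ∨
  ((h ≤ 2 * x ∧ h ≤ 1 - x) ∧ L = .inr F.1)

/-- A closed region of the plane: a component of the complement of all crossing edges, together
with its boundary. -/
def region (L : BipyramidFace s ⊕ Fin (s - 2)) : Set Plane :=
  ⋃ F : BipyramidFace s, cellImage F {p | HasLabel F p.1 p.2 L}

lemma mem_region {L : BipyramidFace s ⊕ Fin (s - 2)} {w : Plane} : w ∈ region L ↔
    ∃ (F : BipyramidFace s) (x h : ℝ), HasLabel F x h L ∧ IsCellCoord F x h ∧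
      cellPoint F x h = w :=
  Set.mem_iUnion

lemma isClosed_region (L : BipyramidFace s ⊕ Fin (s - 2)) : IsClosed (region L) := by
  refine isClosed_iUnion_of_finite fun F => isClosed_cellImage F ?_
  have h₁ : IsClosed {p : ℝ × ℝ | 2 * p.1 ≤ p.2} := isClosed_le (by fun_prop) (by fun_prop)
  have h₂ : IsClosed {p : ℝ × ℝ | p.2 ≤ 2 * p.1} := isClosed_le (by fun_prop) (by fun_prop)
  have h₃ : IsClosed {p : ℝ × ℝ | 1 - p.1 ≤ p.2} := isClosed_le (by fun_prop) (by fun_prop)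
  have h₄ : IsClosed {p : ℝ × ℝ | p.2 ≤ 1 - p.1} := isClosed_le (by fun_prop) (by fun_prop)
  exact (h₁.inter isClosed_const).union
    (((h₂.inter h₃).inter isClosed_const).union ((h₂.inter h₄).inter isClosed_const))

lemma exists_mem_region (hs : 8 ≤ s) (w : Plane) : ∃ L : BipyramidFace s ⊕ Fin (s - 2), w ∈ region L := by
  obtain ⟨F, x, h, hc, rfl⟩ := exists_cellPoint_eq (n := s - 2) (by omega) w
  rcases le_total (2 * x) h with h₁ | h₁
  · exact ⟨_, mem_region.2 ⟨F, x, h, .inl ⟨h₁, rfl⟩, hc, rfl⟩⟩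
  · rcases le_total (1 - x) h with h₂ | h₂
    · exact ⟨_, mem_region.2 ⟨F, x, h, .inr (.inl ⟨⟨h₁, h₂⟩, rfl⟩), hc, rfl⟩⟩
    · exact ⟨_, mem_region.2 ⟨F, x, h, .inr (.inr ⟨⟨h₁, h₂⟩, rfl⟩), hc, rfl⟩⟩

/-- The points on crossing edges and the points of the vertices. -/
def crossedSet : Set Plane :=
  Set.range (vertexPoint hs) ∪
    ⋃ F : BipyramidFace s, Set.range (Shape.curve F .paired) ∪ Set.range (Shape.curve F .toRight)

lemma left_mem_crossedSet (F : BipyramidFace s) : cellPoint F 0 0 ∈ crossedSet hs :=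
  .inl ⟨_, (cellPoint_left hs F).symm⟩

lemma right_mem_crossedSet (F : BipyramidFace s) : cellPoint F 1 0 ∈ crossedSet hs :=
  .inl ⟨_, (cellPoint_right hs F).symm⟩

lemma apex_mem_crossedSet (F : BipyramidFace s) {x : ℝ} (h₀ : 0 ≤ x) (h₁ : x ≤ 1) :
    cellPoint F x 1 ∈ crossedSet hs :=
  .inl ⟨_, (cellPoint_apex hs F h₀ h₁).symm⟩

lemma paired_mem_crossedSet (F : BipyramidFace s) {x h : ℝ} (h₀ : 0 ≤ h) (h₁ : h ≤ 1)
    (hx : 2 * x = h) : cellPoint F x h ∈ crossedSet hs := by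
  refine .inr (Set.mem_iUnion.2 ⟨F, .inl ⟨⟨h, h₀, h₁⟩, ?_⟩⟩)
  rw [Shape.curve_apply]
  simp only [Shape.coord]
  congr 1
  linarith

lemma toRight_mem_crossedSet (F : BipyramidFace s) {x h : ℝ} (h₀ : 1 / 4 ≤ x) (h₁ : x ≤ 1)
    (hx : 1 - x = h) : cellPoint F x h ∈ crossedSet hs := by
  refine .inr (Set.mem_iUnion.2 ⟨F, .inr ⟨⟨(4 * x - 1) / 3, by linarith, by linarith⟩, ?_⟩⟩)
  rw [Shape.curve_apply]
  simp only [Shape.coord]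
  congr 1 <;> linarith

lemma mem_crossedSet_of_same {F : BipyramidFace s} {x h : ℝ} (hc : IsCellCoord F x h)
    {L L' : BipyramidFace s ⊕ Fin (s - 2)} (hL : HasLabel F x h L) (hL' : HasLabel F x h L')
    (hne : L ≠ L') : cellPoint F x h ∈ crossedSet hs := by
  obtain ⟨hx₀, hx₁, hh₀, hh₁, -⟩ := hc
  rcases hL with ⟨h₁, rfl⟩ | ⟨h₁, rfl⟩ | ⟨h₁, rfl⟩ <;>
    rcases hL' with ⟨h₂, rfl⟩ | ⟨h₂, rfl⟩ | ⟨h₂, rfl⟩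
  · exact absurd rfl hne
  · exact paired_mem_crossedSet hs F hh₀ hh₁ (by linarith [h₂.1])
  · exact paired_mem_crossedSet hs F hh₀ hh₁ (by linarith [h₂.1])
  · exact paired_mem_crossedSet hs F hh₀ hh₁ (by linarith [h₁.1])
  · exact absurd rfl hne
  · exact toRight_mem_crossedSet hs F (by linarith [h₁.1, h₁.2]) hx₁ (by linarith [h₁.2, h₂.2])
  · exact paired_mem_crossedSet hs F hh₀ hh₁ (by linarith [h₁.1])
  · exact toRight_mem_crossedSet hs F (by linarith [h₂.1, h₂.2]) hx₁ (by linarith [h₁.2, h₂.2])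
  · exact absurd rfl hne

/-- Across a side between two cells, the label does not change. -/
lemma mem_crossedSet_of_side {F G : BipyramidFace s} {h : ℝ} (hh₀ : 0 ≤ h) (hh₁ : h ≤ 1)
    {L L' : BipyramidFace s ⊕ Fin (s - 2)} (hL : HasLabel F 1 h L) (hL' : HasLabel G 0 h L')
    (hne : L ≠ L') (hG : G.1 = finRotate (s - 2) F.1) (hFG : h = 0 ∨ F.2 = G.2) :
    cellPoint F 1 h ∈ crossedSet hs := by
  by_cases h0 : h = 0
  · subst h0
    exact right_mem_crossedSet hs F
  · have hpos : 0 < h := lt_of_le_of_ne hh₀ (Ne.symm h0)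
    rcases hL with ⟨h₁, rfl⟩ | ⟨h₁, rfl⟩ | ⟨h₁, rfl⟩
    · linarith
    · rcases hL' with ⟨h₂, rfl⟩ | ⟨h₂, rfl⟩ | ⟨h₂, rfl⟩
      · refine absurd ?_ hne
        rw [← hG, hFG.resolve_left h0]
      · linarith [h₂.1]
      · linarith [h₂.1]
    · linarith [h₁.2]

lemma mem_crossedSet_of_regions {L L' : BipyramidFace s ⊕ Fin (s - 2)} (hne : L ≠ L') {w : Plane}
    (hw : w ∈ region L) (hw' : w ∈ region L') : w ∈ crossedSet hs := by
  obtain ⟨F, x, h, hL, hc, rfl⟩ := mem_region.1 hw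
  obtain ⟨G, y, k, hL', hc', he⟩ := mem_region.1 hw'
  have hg := (cellPoint_eq_iff hc hc').1 he.symm
  have hc₀ := hc
  obtain ⟨hx₀, hx₁, hh₀, hh₁, -⟩ := hc
  obtain ⟨rfl, ⟨rfl, -⟩ | ⟨h₁, ⟨h₂, rfl⟩ | ⟨rfl, rfl, h₂⟩ | ⟨rfl, rfl, h₂⟩⟩⟩ := hg
  · exact apex_mem_crossedSet hs F hx₀ hx₁
  · rcases h₁ with rfl | h₁
    · rcases hL with ⟨h₃, rfl⟩ | ⟨h₃, rfl⟩ | ⟨h₃, rfl⟩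
      · obtain rfl : x = 0 := by linarith
        exact left_mem_crossedSet hs F
      · obtain rfl : x = 1 := by linarith [h₃.2]
        exact right_mem_crossedSet hs F
      · rcases hL' with ⟨h₄, rfl⟩ | ⟨h₄, rfl⟩ | ⟨h₄, rfl⟩
        · obtain rfl : x = 0 := by linarith
          exact left_mem_crossedSet hs F
        · obtain rfl : x = 1 := by linarith [h₄.2]
          exact right_mem_crossedSet hs F
        · exact absurd (by rw [h₂]) hne
    · obtain rfl : F = G := Prod.ext h₂ h₁
      exact mem_crossedSet_of_same hs hc₀ hL hL' hne
  · exact mem_crossedSet_of_side hs hh₀ hh₁ hL hL' hne h₂ h₁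
  · rw [← he]
    exact mem_crossedSet_of_side hs hh₀ hh₁ hL' hL hne.symm h₂ (h₁.imp_right Eq.symm)

/-- The vertices of a closed region: three vertices of an inserted `K_4`, or the two ends of a
base-edge. -/
lemma vertices_of_region {v : BipyramidVertex s ⊕ BipyramidFace s}
    {L : BipyramidFace s ⊕ Fin (s - 2)} (hv : vertexPoint hs v ∈ region L) :
    (∃ F : BipyramidFace s, L = .inl F ∧ (v = .inl F.apex ∨ v = .inl F.left ∨ v = .inr F)) ∨
    (∃ i, L = .inr i ∧ (v = .inl (.inl i) ∨ v = .inl (.inl (finRotate _ i)))) := by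
  obtain ⟨F, x, h, hL, hc, he⟩ := mem_region.1 hv
  obtain (j | σ) | G := v <;> simp only [vertexPoint] at he
  · rw [cellPoint_eq_iff hc (isCellCoord_base _ le_rfl zero_le_one)] at he
    obtain ⟨rfl, ⟨h₁, -⟩ | ⟨-, ⟨h₂, rfl⟩ | ⟨rfl, -, h₂⟩ | ⟨-, h₂, -⟩⟩⟩ := he
    · norm_num at h₁
    · obtain rfl : F.1 = j := h₂
      rcases hL with ⟨h₃, rfl⟩ | ⟨h₃, rfl⟩ | ⟨h₃, rfl⟩
      · exact .inl ⟨F, rfl, .inr (.inl rfl)⟩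
      · linarith [h₃.2]
      · exact .inr ⟨_, rfl, .inl rfl⟩
    · obtain rfl : j = finRotate _ F.1 := h₂
      rcases hL with ⟨h₃, rfl⟩ | ⟨h₃, rfl⟩ | ⟨h₃, rfl⟩
      · linarith
      · exact .inl ⟨_, rfl, .inr (.inl rfl)⟩
      · exact .inr ⟨_, rfl, .inr rfl⟩
    · norm_num at h₂
  · rw [cellPoint_eq_iff hc (isCellCoord_apex _ le_rfl zero_le_one)] at he
    obtain ⟨rfl, hσ⟩ := he
    obtain rfl : F.2 = σ := by
      rcases hσ with ⟨-, hσ⟩ | ⟨hσ | hσ, -⟩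
      · exact hσ
      · norm_num at hσ
      · exact hσ
    rcases hL with ⟨h₃, rfl⟩ | ⟨h₃, rfl⟩ | ⟨h₃, rfl⟩
    · exact .inl ⟨F, rfl, .inl rfl⟩
    · exact .inl ⟨_, rfl, .inl rfl⟩
    · linarith [h₃.1, h₃.2]
  · rw [cellPoint_eq_iff hc (isCellCoord_new _)] at he
    obtain ⟨rfl, rfl, rfl⟩ :=
      he.symm.eq_of_inner (by norm_num) (by norm_num) (by norm_num) (by norm_num)
    rcases hL with ⟨h₃, rfl⟩ | ⟨h₃, rfl⟩ | ⟨h₃, rfl⟩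
    · exact .inl ⟨G, rfl, .inr (.inr rfl)⟩
    · linarith [h₃.1]
    · linarith [h₃.1]

lemma adj_of_mem_region {u v : BipyramidVertex s ⊕ BipyramidFace s} (huv : u ≠ v)
    {L : BipyramidFace s ⊕ Fin (s - 2)} (hu : vertexPoint hs u ∈ region L)
    (hv : vertexPoint hs v ∈ region L) : (bipyramidK4 s).Adj u v := by
  rcases vertices_of_region hs hu with ⟨F, rfl, hu'⟩ | ⟨i, rfl, hu'⟩
  · rcases vertices_of_region hs hv with ⟨G, hG, hv'⟩ | ⟨i, hi, hv'⟩
    · obtain rfl := Sum.inl_injective hG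
      have ha : F.apex ∈ F.verts := .inl rfl
      have hl : F.left ∈ F.verts := .inr (.inl rfl)
      rcases hu' with rfl | rfl | rfl <;> rcases hv' with rfl | rfl | rfl
      · exact absurd rfl huv
      · exact trivial
      · exact ha
      · exact trivial
      · exact absurd rfl huv
      · exact hl
      · exact ha
      · exact hl
      · exact absurd rfl huv
    · cases hi
  · rcases vertices_of_region hs hv with ⟨G, hG, hv'⟩ | ⟨j, hj, hv'⟩
    · cases hG
    · obtain rfl := Sum.inr_injective hj
      have hadj : (SimpleGraph.cycleGraph (s - 2)).Adj i (finRotate _ i) :=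
        (cycleGraph_adj_iff_finRotate (by omega)).2 (.inl rfl)
      rcases hu' with rfl | rfl <;> rcases hv' with rfl | rfl
      · exact absurd rfl huv
      · exact hadj
      · exact hadj.symm
      · exact absurd rfl huv

/-- A connected set off the crossing edges stays inside one region. -/
lemma IsPreconnected.subset_region {Y : Set Plane} (hY : IsPreconnected Y)
    (hd : Disjoint Y (crossedSet hs)) :
    ∃ L : BipyramidFace s ⊕ Fin (s - 2), Y ⊆ region L := by
  rcases Y.eq_empty_or_nonempty with rfl | ⟨y, hy⟩
  · exact ⟨.inr ⟨0, by omega⟩, Set.empty_subset _⟩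
  obtain ⟨L, hL⟩ := exists_mem_region hs y
  refine ⟨L, ?_⟩
  set C : Set Plane := ⋃ L' ∈ {L' | L' ≠ L}, region L' with hC
  have hCcl : IsClosed C := Set.Finite.isClosed_biUnion (Set.toFinite _) fun _ _ => isClosed_region _
  have hcov : Y ⊆ region L ∪ C := by
    intro w _
    obtain ⟨L', hL'⟩ := exists_mem_region hs w
    by_cases h : L' = L
    · exact .inl (h ▸ hL')
    · exact .inr (Set.mem_biUnion (show L' ∈ {L' | L' ≠ L} from h) hL')
  intro w hw
  refine (hcov hw).resolve_right fun hwC => ?_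
  obtain ⟨z, hz, hzL, hzC⟩ := isPreconnected_closed_iff.1 hY _ _ (isClosed_region L) hCcl hcov
    ⟨y, hy, hL⟩ ⟨w, hw, hwC⟩
  obtain ⟨L', hL', hzL'⟩ := Set.mem_iUnion₂.1 hzC
  exact Set.disjoint_left.1 hd hz (mem_crossedSet_of_regions hs hL' hzL' hzL)

/-- Every crossing edge of the drawing has a crossing, and the curves of the crossing edges are
those of the indices `paired` and `toRight`. -/
lemma exists_crossed_edge (F : BipyramidFace s) :
    ∃ (f g : (bipyramidK4 s).edgeSet) (p : Plane), (bipyramidK4System hs).toDrawing.CrossAt f g p ∧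
      (bipyramidK4System hs).toDrawing.curve f = Shape.curve F .paired ∧
      (bipyramidK4System hs).toDrawing.curve g = Shape.curve F .toRight := by
  have hf₀ : s(.inl F.apex, .inl F.left) ∈ (bipyramidK4 s).edgeSet := trivial
  have hg₀ : s(.inr F, .inl F.right) ∈ (bipyramidK4 s).edgeSet := .inr (.inr rfl)
  obtain ⟨p, hp⟩ := (isCrossedK4Insertion hs).crossing F ⟨s(_, _), hf₀⟩ ⟨s(_, _), hg₀⟩ rfl rfl
  have hf' := BipyramidK4Edge.eq_paired hs ((bipyramidK4System hs).ends_index ⟨s(_, _), hf₀⟩)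
  have hg' := BipyramidK4Edge.eq_toRight hs ((bipyramidK4System hs).ends_index ⟨s(_, _), hg₀⟩)
  refine ⟨⟨s(_, _), hf₀⟩, ⟨s(_, _), hg₀⟩, p, hp, ?_, ?_⟩
  · change Shape.curve _ _ = _
    rw [hf']
  · change Shape.curve _ _ = _
    rw [hg']

lemma Drawing.CrossAt.symm {V : Type*} {G : SimpleGraph V} {D : Drawing G} {e f : G.edgeSet}
    {p : Plane} (h : D.CrossAt e f p) : D.CrossAt f e p :=
  ⟨h.1.symm, h.2.2.1, h.2.1, fun ⟨v, hv, hv', hp⟩ => h.2.2.2 ⟨v, hv', hv, hp⟩⟩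

/-- The inside of an edge that is added to the drawing avoids all vertices and, by 1-planarity, all
edges that are crossed already; so it lies in one region, and the ends of the edge are
adjacent. -/
lemma isSimpleSaturated : (bipyramidK4System hs).toDrawing.IsSimpleSaturated := by
  refine ⟨(bipyramidK4System hs).isKPlanar_one, fun u v huv hadj D' hext hpl => hadj ?_⟩
  have he₀ : (bipyramidK4 s ⊔ SimpleGraph.edge u v).Adj u v := by
    simp [SimpleGraph.edge_adj, huv]
  set e : (bipyramidK4 s ⊔ SimpleGraph.edge u v).edgeSet := ⟨s(u, v), he₀⟩ with he
  have heG : e.1 ∉ (bipyramidK4 s).edgeSet := hadj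
  have hpos : D'.pos = vertexPoint hs := hext.2.1
  have hvert : ∀ t, t ≠ 0 → t ≠ 1 → ∀ w, D'.curve e t ≠ vertexPoint hs w := by
    intro t ht₀ ht₁ w hw
    rw [← hpos] at hw
    rcases D'.vertex_on_curve e t w hw with h | h
    · exact ht₀ h
    · exact ht₁ h
  have hcross : ∀ t, t ≠ 0 → t ≠ 1 → ∀ f g p,
      (bipyramidK4System hs).toDrawing.CrossAt f g p →
      D'.curve e t ∉ Set.range ((bipyramidK4System hs).toDrawing.curve f) := by
    intro t ht₀ ht₁ f g p hfg hmem
    have hf' : f.1 ∈ (bipyramidK4 s ⊔ SimpleGraph.edge u v).edgeSet :=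
      SimpleGraph.edgeSet_mono hext.1 f.2
    refine Drawing.not_crossAt_of_extends hext hpl hfg heG (f' := ⟨f.1, hf'⟩) rfl
      (p := D'.curve e t) ⟨fun h => heG (h ▸ f.2), ?_, ⟨t, rfl⟩, ?_⟩
    · rwa [hext.2.2 f ⟨f.1, hf'⟩ rfl]
    · rintro ⟨w, -, -, hw⟩
      rw [hpos] at hw
      exact hvert t ht₀ ht₁ w hw
  have hY : IsPreconnected (D'.curve e '' Set.Ioo 0 1) :=
    isPreconnected_Ioo.image _ (D'.curve e).continuous.continuousOn
  have hd : Disjoint (D'.curve e '' Set.Ioo 0 1) (crossedSet hs) := by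
    rw [Set.disjoint_left]
    rintro _ ⟨t, ⟨ht₀, ht₁⟩, rfl⟩ (⟨w, hw⟩ | hw)
    · exact hvert t ht₀.ne' ht₁.ne w hw.symm
    · obtain ⟨F, hw⟩ := Set.mem_iUnion.1 hw
      obtain ⟨f, g, p, hfg, hf, hg⟩ := exists_crossed_edge hs F
      rcases hw with hw | hw
      · rw [← hf] at hw
        exact hcross t ht₀.ne' ht₁.ne f g p hfg hw
      · rw [← hg] at hw
        exact hcross t ht₀.ne' ht₁.ne g f p hfg.symm hw
  obtain ⟨L, hL⟩ := hY.subset_region hs hd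
  have hends : ∀ t, D'.curve e t ∈ region L := by
    intro t
    refine closure_minimal hL (isClosed_region L) (image_closure_subset_closure_image
      (D'.curve e).continuous ⟨t, ?_, rfl⟩)
    rw [closure_Ioo zero_ne_one]
    exact ⟨unitInterval.nonneg', unitInterval.le_one'⟩
  have hs' := D'.ends e
  rw [he, Sym2.map_mk, hpos] at hs'
  rcases Sym2.eq_iff.1 hs' with ⟨h₀, h₁⟩ | ⟨h₀, h₁⟩
  · exact adj_of_mem_region hs huv (h₀ ▸ hends 0) (h₁ ▸ hends 1)
  · exact adj_of_mem_region hs huv (h₁ ▸ hends 1) (h₀ ▸ hends 0)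

end Regions

/-! ### Connectivity and matchings -/

lemma exists_notMem_of_card_lt {s : ℕ} (S : Finset (BipyramidVertex s ⊕ BipyramidFace s))
    (hS : S.card < s - 2) : ∃ i : Fin (s - 2), .inl (.inl i) ∉ S := by
  by_contra! h
  have := Finset.card_le_card_of_injOn (s := Finset.univ) (t := S)
    (fun i : Fin (s - 2) => (.inl (.inl i) : BipyramidVertex s ⊕ BipyramidFace s))
    (fun i _ => h i) fun i _ j _ hij => Sum.inl_injective (Sum.inl_injective hij)
  rw [Finset.card_univ, Fintype.card_fin] at this
  omega

/-- After the deletion of at most two vertices, either an apex is left as a hub, or the whole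
base-cycle is left; every inserted vertex keeps one of its three neighbours. -/
lemma isKConnected_bipyramidK4 {s : ℕ} (hs : 8 ≤ s) : IsKConnected 3 (bipyramidK4 s) := by
  constructor
  · simp only [Fintype.card_sum, Fintype.card_prod, Fintype.card_fin, Fintype.card_bool]
    omega
  intro S hS
  set T : Set (BipyramidVertex s ⊕ BipyramidFace s) := (S : Set _)ᶜ
  set H := (bipyramidK4 s).induce T
  have hadj : ∀ {a b : BipyramidVertex s ⊕ BipyramidFace s} (ha : a ∈ T)
      (hb : b ∈ T), (bipyramidK4 s).Adj a b → H.Reachable ⟨a, ha⟩ ⟨b, hb⟩ :=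
    fun ha hb h => SimpleGraph.Adj.reachable (show H.Adj ⟨_, ha⟩ ⟨_, hb⟩ from h)
  -- the vertices of the bipyramid that are left are reachable from one vertex
  have hhub : ∃ r : T,
      ∀ (v : BipyramidVertex s)
      (hv : .inl v ∈ T), H.Reachable r ⟨.inl v, hv⟩ := by
    by_cases hapex : ∃ σ, .inl (.inr σ) ∉ S
    · obtain ⟨σ, hσ⟩ := hapex
      have hbase : ∀ (i : Fin (s - 2)) (hi : .inl (.inl i) ∈ T),
          H.Reachable ⟨.inl (.inr σ), hσ⟩ ⟨.inl (.inl i), hi⟩ := fun i hi => hadj _ _ trivial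
      refine ⟨⟨.inl (.inr σ), hσ⟩, ?_⟩
      rintro (i | τ) hv
      · exact hbase i hv
      · obtain ⟨i, hi⟩ := exists_notMem_of_card_lt S (by omega)
        exact (hbase i hi).trans (hadj _ _ trivial)
    · push Not at hapex
      have hSeq : S = {.inl (.inr true), .inl (.inr false)} := by
        symm
        apply Finset.eq_of_subset_of_card_le
        · intro a ha
          simp only [Finset.mem_insert, Finset.mem_singleton] at ha
          rcases ha with rfl | rfl <;> exact hapex _
        · rw [Finset.card_pair (by simp)]
          omega
      have hbase : ∀ i : Fin (s - 2), .inl (.inl i) ∈ T := by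
        intro i
        simp [T, hSeq]
      let f : SimpleGraph.cycleGraph (s - 2) →g H :=
        ⟨fun i => ⟨.inl (.inl i), hbase i⟩, fun h => h⟩
      refine ⟨⟨_, hbase ⟨0, by omega⟩⟩, ?_⟩
      rintro (i | τ) hv
      · exact (SimpleGraph.cycleGraph_preconnected ⟨0, by omega⟩ i).map f
      · exact absurd (hapex τ) hv
  obtain ⟨r, hr⟩ := hhub
  have hall : ∀ v, H.Reachable r v := by
    rintro ⟨v | F, hv⟩
    · exact hr v hv
    · have hcard : ({.inl F.apex, .inl F.left, .inl F.right} :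
          Finset (BipyramidVertex s ⊕ BipyramidFace s)).card = 3 := by
        have hne : F.left ≠ F.right := fun h =>
          ne_finRotate (by omega) F.1 (Sum.inl_injective h)
        rw [Finset.card_eq_three]
        exact ⟨_, _, _, by simp [BipyramidFace.apex, BipyramidFace.left],
          by simp [BipyramidFace.apex, BipyramidFace.right], fun h => hne (Sum.inl_injective h), rfl⟩
      obtain ⟨a, ha, haS⟩ := Finset.exists_mem_notMem_of_card_lt_card (hS.trans_eq hcard.symm)
      obtain ⟨u, hu, rfl⟩ : ∃ u ∈ F.verts, a = .inl u := by
        simp only [Finset.mem_insert, Finset.mem_singleton] at ha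
        rcases ha with rfl | rfl | rfl
        · exact ⟨_, .inl rfl, rfl⟩
        · exact ⟨_, .inr (.inl rfl), rfl⟩
        · exact ⟨_, .inr (.inr rfl), rfl⟩
      exact (hr u haS).trans (hadj haS hv hu)
  have : Nonempty T := ⟨r⟩
  exact SimpleGraph.connected_iff _ |>.2 ⟨fun u v => (hall u).symm.trans (hall v), this⟩

/-- The inserted vertices are pairwise non-adjacent, so every edge of a matching covers its own
vertex of the bipyramid. -/
lemma matchingNumber_bipyramidK4_le {s : ℕ} (hs : 2 ≤ s) : matchingNumber (bipyramidK4 s) ≤ s := by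
  unfold matchingNumber
  apply csSup_le'
  rintro m ⟨M, hM, rfl⟩
  have hex : ∀ e ∈ M.edgeSet, ∃ v : BipyramidVertex s, .inl v ∈ e := by
    rintro ⟨⟨u, w⟩⟩ he
    have hadj := M.adj_sub he
    obtain u | F := u
    · exact ⟨u, Sym2.mem_mk_left _ _⟩
    · obtain w | G := w
      · exact ⟨w, Sym2.mem_mk_right _ _⟩
      · exact hadj.elim
  choose! f hf using hex
  have hinj : Set.InjOn f M.edgeSet := by
    intro e he e' he' hee
    have h := hf e he
    have h' := hf e' he'
    rw [← hee] at h'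
    obtain ⟨a, ha⟩ := Sym2.mem_iff_exists.1 h
    obtain ⟨b, hb⟩ := Sym2.mem_iff_exists.1 h'
    rw [ha] at he
    rw [hb] at he'
    rw [ha, hb]
    exact congrArg _ (hM.eq_of_adj_left he he')
  calc M.edgeSet.ncard ≤ (Set.univ : Set (BipyramidVertex s)).ncard :=
        Set.ncard_le_ncard_of_injOn f (fun _ _ => Set.mem_univ _) hinj
    _ = s := by
        rw [Set.ncard_univ, Nat.card_eq_fintype_card, Fintype.card_sum, Fintype.card_fin,
          Fintype.card_bool]
        omega

theorem mainTheorem7 (N : ℕ) :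
    ∃ s : ℕ, 8 ≤ s ∧ Even s ∧
      N ≤ Fintype.card (BipyramidVertex s ⊕ BipyramidFace s) ∧
      IsKConnected 3 (bipyramidK4 s) ∧
      (matchingNumber (bipyramidK4 s) : ℝ) ≤
        ((Fintype.card (BipyramidVertex s ⊕ BipyramidFace s) : ℝ) + 4) / 3 ∧
      ∃ (B : Drawing (bipyramid s)) (D : Drawing (bipyramidK4 s)),
        IsCrossedK4Insertion B D ∧ D.IsSimpleSaturated := by
  have hs : 8 ≤ 2 * (N + 4) := by omega
  have hcard : Fintype.card (BipyramidVertex (2 * (N + 4)) ⊕ BipyramidFace (2 * (N + 4))) + 4 =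
      3 * (2 * (N + 4)) := by
    simp only [Fintype.card_sum, Fintype.card_prod, Fintype.card_fin, Fintype.card_bool]
    omega
  refine ⟨2 * (N + 4), hs, even_two_mul _, by omega, isKConnected_bipyramidK4 hs, ?_,
    (bipyramidSystem hs).toDrawing, (bipyramidK4System hs).toDrawing, isCrossedK4Insertion hs,
    isSimpleSaturated hs⟩
  have hm : matchingNumber (bipyramidK4 (2 * (N + 4))) ≤ 2 * (N + 4) :=
    matchingNumber_bipyramidK4_le (by omega)
  rw [le_div_iff₀ (by norm_num)]
  have h₁ : (matchingNumber (bipyramidK4 (2 * (N + 4))) : ℝ) ≤ (2 * (N + 4) : ℕ) :=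
    Nat.cast_le.2 hm
  have h₂ : (Fintype.card (BipyramidVertex (2 * (N + 4)) ⊕ BipyramidFace (2 * (N + 4))) : ℝ) + 4 =
      3 * (2 * (N + 4) : ℕ) := by exact_mod_cast hcard
  rw [h₂]
  linarith
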